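/- Define rational functions over $\mathbb Q$ by \[ F_1(t)=27\frac{(t+1)(t+9)^3}{t^3},\quad F_2(t)=t(t^2+3t+3),\quad G_1(t)=t^3,\quad G_2(t)=\frac{3(t+1)(t-3)}{t},\quad G_3(t)=\frac{t^2+3t+3}{t}. \] Then $F_1(F_2(t))=G_1(G_2(G_3(t)))$ in $\mathbb Q(t)$. Let $E/\mathbb Q$ be an elliptic curve without complex multiplication (every endomorphism of $E$ over $\overline{\mathbb Q}$ is multiplication by an integer), with $j$-invariant $j(E)$. Let $\mathbb Q(E[3])\subset\overline{\mathbb Q}$ be the field generated by the coordinates of the $3$-torsion points of $E$, and let $K\subset\overline{\mathbb Q}$ be the splitting field of the $3$-division polynomial of $E$. Then $K$ is the field generated over $\mathbb Q$ by the $x$-coordinates of the nonzero $3$-torsion points of $E$; the extensions $\mathbb Q(E[3])/\mathbb Q$ and $K/\mathbb Q$ are Galois; and their Galois groups are as follows. For a composite $H=H_1\circ\dots\circ H_m$ of the functions above, $H(\mathbb Q^*)$ is the set of values of $H$ at nonzero rational numbers; $D_n$ is the dihedral group of order $2n$ and $SD_{16}$ the semidihedral group of order $16$. 1. If $j(E)\notin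 F_1(\mathbb Q^*)$ and $j(E)\notin G_1(\mathbb Q^*)$, then $\operatorname{Gal}(\mathbb Q(E[3])/\mathbb Q)\cong \mathrm{GL}_2(\mathbb F_3)$ and $\operatorname{Gal}(K/\mathbb Q)\cong S_4$. 2. If $j(E)\in F_1(\mathbb Q^*)$ and $j(E)\notin F_1(F_2(\mathbb Q^*))$, then $\operatorname{Gal}(\mathbb Q(E[3])/\mathbb Q)\cong S_3$ or $D_6$, and $\operatorname{Gal}(K/\mathbb Q)\cong S_3$. Moreover, there is $d\in\mathbb Q^*$ such that the quadratic twist $E^d$ of $E$ by $d$ has $\operatorname{Gal}(\mathbb Q(E^d[3])/\mathbb Q)\cong D_6$. 3. If $j(E)\in G_1(\mathbb Q^*)$ and $j(E)\notin G_1(G_2(\mathbb Q^*))$, then $\operatorname{Gal}(\mathbb Q(E[3])/\mathbb Q)\cong SD_{16}$ and $\operatorname{Gal}(K/\mathbb Q)\cong D_4$. 4. If $j(E)\in G_1(G_2(\mathbb Q^*))$ and $j(E)\notin G_1(G_2(G_3(\mathbb Q^*)))$, then $\operatorname{Gal}(\mathbb Q(E[3])/\mathbb Q)\cong D_4$ and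 $\operatorname{Gal}(K/\mathbb Q)\cong C_2^2$. 5. In all other cases, $\operatorname{Gal}(\mathbb Q(E[3])/\mathbb Q)\cong C_2$ or $C_2^2$, and $\operatorname{Gal}(K/\mathbb Q)\cong C_2$. Moreover, there is $d\in\mathbb Q^*$ such that the quadratic twist $E^d$ of $E$ by $d$ has $\operatorname{Gal}(\mathbb Q(E^d[3])/\mathbb Q)\cong C_2^2$. -/

import Mathlib

open Polynomial

noncomputable section

/-! ### Endomorphisms and complex multiplication -/

section Endomorphisms

open scoped Classical in
/-- An endomorphism of a Weierstrass curve `W` over a field `F` (to be used for elliptic curves over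
algebraically closed `F`): a group homomorphism `φ : W(F) → W(F)` given by rational functions, that
is, either `φ = 0` or there are polynomials `p, q, r` in two variables such that
`φ (x, y) = (p (x, y) / r (x, y), q (x, y) / r (x, y))` with `r (x, y) ≠ 0`
for all but finitely many points of `W(F)`. -/
def IsAlgebraicEndomorphism {F : Type*} [Field F] (W : WeierstrassCurve.Affine F)
    (φ : W.Point →+ W.Point) : Prop :=
  φ = 0 ∨ ∃ p q r : F[X][X],
    {P : W.Point | ¬ ∃ (x y : F) (h : W.Nonsingular x y)
      (h' : W.Nonsingular (p.evalEval x y / r.evalEval x y) (q.evalEval x y / r.evalEval x y)),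
      P = .some x y h ∧ r.evalEval x y ≠ 0 ∧ φ P = .some _ _ h'}.Finite

open scoped Classical in
/-- A curve `E` over `ℚ` has complex multiplication if, over the algebraic closure of `ℚ`, it has
an endomorphism that is not multiplication by an integer. -/
def HasCM (E : WeierstrassCurve ℚ) : Prop :=
  ∃ φ : (E.baseChange (AlgebraicClosure ℚ)).toAffine.Point →+
      (E.baseChange (AlgebraicClosure ℚ)).toAffine.Point,
    IsAlgebraicEndomorphism (E.baseChange (AlgebraicClosure ℚ)).toAffine φ ∧
      ∀ n : ℤ, ¬ ∀ P, φ P = n • P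

end Endomorphisms

/-! ### Division fields -/

open scoped Classical in
/-- The set of `x`-coordinates in `ℚ̄` of the nonzero `3`-torsion points of `E`. -/
def torsionX (E : WeierstrassCurve ℚ) : Set (AlgebraicClosure ℚ) :=
  {x | ∃ (y : AlgebraicClosure ℚ) (h : (E.baseChange (AlgebraicClosure ℚ)).toAffine.Nonsingular x y),
    3 • (WeierstrassCurve.Affine.Point.some x y h) = 0}

open scoped Classical in
/-- The set of `y`-coordinates in `ℚ̄` of the nonzero `3`-torsion points of `E`. -/
def torsionY (E : WeierstrassCurve ℚ) : Set (AlgebraicClosure ℚ) :=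
  {y | ∃ (x : AlgebraicClosure ℚ) (h : (E.baseChange (AlgebraicClosure ℚ)).toAffine.Nonsingular x y),
    3 • (WeierstrassCurve.Affine.Point.some x y h) = 0}

/-- The field `ℚ(E[3])` generated by the coordinates of the `3`-torsion points. -/
def torsionField (E : WeierstrassCurve ℚ) : IntermediateField ℚ (AlgebraicClosure ℚ) :=
  IntermediateField.adjoin ℚ (torsionX E ∪ torsionY E)

/-- The splitting field (inside `ℚ̄`) of the `3`-division polynomial of `E`. -/
def divisionPolynomialField (E : WeierstrassCurve ℚ) :
    IntermediateField ℚ (AlgebraicClosure ℚ) :=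
  IntermediateField.adjoin ℚ (E.Ψ₃.rootSet (AlgebraicClosure ℚ))

/-- `L/ℚ` is a Galois extension whose Galois group is isomorphic to `G`. -/
def HasGaloisGroup (L : IntermediateField ℚ (AlgebraicClosure ℚ)) (G : Type) [Group G] : Prop :=
  IsGalois ℚ L ∧ Nonempty ((L ≃ₐ[ℚ] L) ≃* G)

/-! ### Quadratic twists -/

/-- The quadratic twist by `d`. Completing the square turns `E` into
`y² = x³ + (b₂/4) x² + (b₄/2) x + b₆/4`; the twist is `d y² = x³ + (b₂/4) x² + (b₄/2) x + b₆/4`,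
written here as a Weierstrass equation after the substitution `(x, y) ↦ (x/d, y/d²)`. -/
def quadraticTwist (E : WeierstrassCurve ℚ) (d : ℚ) : WeierstrassCurve ℚ where
  a₁ := 0
  a₂ := d * (E.b₂ / 4)
  a₃ := 0
  a₄ := d ^ 2 * (E.b₄ / 2)
  a₆ := d ^ 3 * (E.b₆ / 4)

theorem quadraticTwist_discriminant (E : WeierstrassCurve ℚ) (d : ℚ) :
    (quadraticTwist E d).Δ = d ^ 6 * E.Δ := by
  simp only [quadraticTwist, WeierstrassCurve.Δ, WeierstrassCurve.b₂, WeierstrassCurve.b₄,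
    WeierstrassCurve.b₆, WeierstrassCurve.b₈]
  ring

/-! ### Finite groups -/

/-- The action of `C₂` on `C₈` in which the nontrivial element acts by `r ↦ r³`. -/
def semidihedralAction : Multiplicative (ZMod 2) →* MulAut (Multiplicative (ZMod 8)) where
  toFun s :=
    { toFun := fun r => r ^ 3 ^ (Multiplicative.toAdd s).val
      invFun := fun r => r ^ 3 ^ (Multiplicative.toAdd s).val
      left_inv := by revert s; decide
      right_inv := by revert s; decide
      map_mul' := fun a b => mul_pow a b _ }
  map_one' := by decide
  map_mul' := by decide

/-- The semidihedral group `⟨r, s | r⁸ = s² = 1, s r s⁻¹ = r³⟩` of order `16`. -/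
abbrev SD16 : Type := Multiplicative (ZMod 8) ⋊[semidihedralAction] Multiplicative (ZMod 2)

/-- The cyclic group of order `2`. -/
abbrev C2 : Type := Multiplicative (ZMod 2)

/-! ### The rational functions -/

section RationalFunctions

variable {k : Type*} [Field k]

def F₁ (t : k) : k := 27 * ((t + 1) * (t + 9) ^ 3 / t ^ 3)

def F₂ (t : k) : k := t * (t ^ 2 + 3 * t + 3)

def G₁ (t : k) : k := t ^ 3

def G₂ (t : k) : k := 3 * (t + 1) * (t - 3) / t

def G₃ (t : k) : k := (t ^ 2 + 3 * t + 3) / t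

end RationalFunctions

/-- The set `ℚ*` of nonzero rational numbers. -/
def ratStar : Set ℚ := {t | t ≠ 0}

end

noncomputable section

/-! ### Subgroups of finite groups -/

/-! In the variable `z = 12x + b₂` the 3-division polynomial becomes `z⁴ - 6c₄z² - 8c₆z - 3c₄²`.
Euler's solution writes its roots as `±s₁ ± s₂ ± s₃`, where the signs keep `s₁s₂s₃ = c₆`, `sᵢ² = c₄
- 12ζⁱ⁻¹δ` and `δ³ = Δ`. Its discriminant is `-3` times a square, so the image of Galois in `S₄`
always contains an odd permutation. For `j ≠ 0` this image is governed by three conditions: a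
rational root (`j ∈ F₁(ℚ*)`), `Δ` a cube (`j ∈ G₁(ℚ*)`), and in addition `(s₂s₃)²` a rational square
(`j ∈ G₁(G₂(ℚ*))`). See `mem_F₁_image_iff`, `mem_G₁_image_iff`, `mem_G₁_G₂_image_iff`. The first two
together mean `j ∈ F₁(F₂(ℚ*))` by `mem_F₁_F₂_image`.

The mod 3 representation lifts the permutation action, and the two kernels differ by `±1`
(`RootData.perm_eq_one_iff_rep`). In cases 1, 3 and 4 the image lies in a group of twice the order
of the permutation image in which `-1` is a square, and this forces equality
(`nonempty_range_mulEquiv_of_square`). In cases 2 and 5 both options for `-1` occur. Twisting by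
`-1` multiplies the ordinates by `i`, so one of the twists by `1` and `-1` has `-1` in its image
(`neg_one_mem_of_twist`).

The absence of complex multiplication serves only to give `j ≠ 0`: a curve with `j = 0` has the
automorphism `orderThree`. -/

theorem nonempty_mulEquiv_of_le_range {A G : Type*} [Group A] [Group G] [Finite A] (f : A →* G)
    (hf : Function.Injective f) (H : Subgroup G) (hH : H ≤ f.range)
    (hc : Nat.card H = Nat.card A) : Nonempty (H ≃* A) := by
  have hr : Nat.card f.range = Nat.card A :=
    (Nat.card_congr (MonoidHom.ofInjective hf).toEquiv).symm
  have : Finite f.range := Finite.of_equiv A (MonoidHom.ofInjective hf).toEquiv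
  have h : H = f.range := by
    apply SetLike.coe_injective
    exact Set.eq_of_subset_of_ncard_le hH (le_of_eq (hr.trans hc.symm)) (Set.toFinite _)
  subst h
  exact ⟨(MonoidHom.ofInjective hf).symm⟩

/-! ### Two homomorphisms whose kernels differ by an involution `z` -/

section TwoHoms

variable {G M P : Type*} [Group G] [Group M] [Group P] (ρ : G →* M) (π : G →* P) (z : M)

theorem ker_eq_of_not_mem_range (hker : ∀ σ, π σ = 1 ↔ ρ σ = 1 ∨ ρ σ = z)
    (hz : z ∉ ρ.range) : ρ.ker = π.ker := by
  ext σ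
  rw [MonoidHom.mem_ker, MonoidHom.mem_ker, hker]
  exact ⟨Or.inl, fun h => h.resolve_right fun h => hz ⟨σ, h⟩⟩

theorem nonempty_range_mulEquiv_range (h : ρ.ker = π.ker) : Nonempty (ρ.range ≃* π.range) :=
  ⟨(QuotientGroup.quotientKerEquivRange ρ).symm.trans
    ((QuotientGroup.quotientMulEquivOfEq h).trans (QuotientGroup.quotientKerEquivRange π))⟩

/-- The kernel of `ρ` has index 2 in that of `π`, because `ρ` maps `π.ker` onto `⟨z⟩`. -/
theorem card_range_eq_two_mul (hker : ∀ σ, π σ = 1 ↔ ρ σ = 1 ∨ ρ σ = z) (hz1 : z ≠ 1)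
    (hz2 : z * z = 1) (hz : z ∈ ρ.range) : Nat.card ρ.range = 2 * Nat.card π.range := by
  have hle : ρ.ker ≤ π.ker := fun σ h => (hker σ).2 (Or.inl h)
  rw [← Subgroup.index_ker, ← Subgroup.index_ker, ← Subgroup.relIndex_mul_index hle,
    Subgroup.relIndex_ker]
  congr 1
  have : π.ker.map ρ = Subgroup.zpowers z := by
    apply le_antisymm
    · rintro _ ⟨σ, hσ, rfl⟩
      rcases (hker σ).1 hσ with h | h
      · rw [h]; exact one_mem _
      · rw [h]; exact Subgroup.mem_zpowers z
    · rw [Subgroup.zpowers_le]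
      obtain ⟨σ, rfl⟩ := hz
      exact ⟨σ, (hker σ).2 (Or.inr rfl), rfl⟩
  rw [this, Nat.card_zpowers]
  exact orderOf_eq_prime (by rw [pow_two, hz2]) hz1

/-- If the image of `ρ` lies in a group of twice the order of the image of `π`, in which the
central involution is a square, then it is the whole group. -/
theorem nonempty_range_mulEquiv_of_square (hker : ∀ σ, π σ = 1 ↔ ρ σ = 1 ∨ ρ σ = z)
    (hz1 : z ≠ 1) (hz2 : z * z = 1) {A : Type*} [Group A] [Finite A] (f : A →* M)
    (hf : Function.Injective f) (hle : ρ.range ≤ f.range)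
    (hcard : Nat.card A = 2 * Nat.card π.range) (a : A) (ha : f a ^ 2 = z) :
    Nonempty (ρ.range ≃* A) := by
  apply nonempty_mulEquiv_of_le_range f hf _ hle
  by_cases hz : z ∈ ρ.range
  · rw [card_range_eq_two_mul ρ π z hker hz1 hz2 hz, hcard]
  · exfalso
    -- Without `z`, the image would be a subgroup of index 2 in `A`. Such a subgroup contains every
    -- square, in particular `z`.
    obtain ⟨e⟩ := nonempty_range_mulEquiv_range ρ π (ker_eq_of_not_mem_range ρ π z hker hz)
    have hc : Nat.card ρ.range = Nat.card π.range := Nat.card_congr e.toEquiv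
    set S := ρ.range.comap f with hS
    have hSc : Nat.card S = Nat.card ρ.range := by
      have : S.map f = ρ.range := Subgroup.map_comap_eq_self hle
      rw [← this]
      exact Nat.card_congr (S.equivMapOfInjective f hf).toEquiv
    have hpos : 0 < Nat.card A := Nat.card_pos
    have hidx : S.index = 2 := by
      have := S.card_mul_index
      rw [hSc, hc, hcard, mul_comm 2] at this
      exact Nat.eq_of_mul_eq_mul_left (by omega) this
    have := Subgroup.sq_mem_of_index_two hidx a
    rw [hS, Subgroup.mem_comap, map_pow, ha] at this
    exact hz this

end TwoHoms

/-- The homomorphism from a cyclic group given by the image of a generator. -/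
def cyclicLift {G : Type*} [Group G] (n : ℕ) [NeZero n] (a : G) (ha : a ^ n = 1) :
    Multiplicative (ZMod n) →* G where
  toFun i := a ^ (Multiplicative.toAdd i).val
  map_one' := by simp
  map_mul' i j := by
    rw [toAdd_mul, ZMod.val_add, ← pow_add, ← pow_mod_orderOf a (_ % n),
      Nat.mod_mod_of_dvd _ (orderOf_dvd_of_pow_eq_one ha), pow_mod_orderOf]

/-- The homomorphism from a dihedral group given by the images of a rotation and a reflection. -/
def dihedralLift {G : Type*} [Group G] (n : ℕ) [NeZero n] (a s : G) (ha : a ^ n = 1)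
    (hs : s * s = 1) (hsa : s * a * s = a⁻¹) : DihedralGroup n →* G where
  toFun
    | .r i => a ^ i.val
    | .sr i => s * a ^ i.val
  map_one' := by
    change a ^ (0 : ZMod n).val = 1
    simp
  map_mul' := by
    have hs' : s⁻¹ = s := inv_eq_of_mul_eq_one_left hs
    have hadd (i j : ZMod n) : a ^ (i + j).val = a ^ i.val * a ^ j.val :=
      (cyclicLift n a ha).map_mul (Multiplicative.ofAdd i) (Multiplicative.ofAdd j)
    have hsub (i j : ZMod n) : a ^ (j - i).val = (a ^ i.val)⁻¹ * a ^ j.val := by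
      rw [eq_inv_mul_iff_mul_eq, ← hadd, add_sub_cancel]
    have hconj (k : ℕ) : a ^ k * s = s * (a ^ k)⁻¹ := by
      have h1 : s * a ^ k * s⁻¹ = (s * a * s⁻¹) ^ k := by rw [conj_pow]
      rw [hs', hsa, inv_pow] at h1
      rw [← h1, ← mul_assoc, ← mul_assoc, hs, one_mul]
    rintro (i | i) (j | j)
    · exact hadd i j
    · change s * a ^ (j - i).val = a ^ i.val * (s * a ^ j.val)
      rw [hsub, ← mul_assoc, ← mul_assoc, hconj]
    · change s * a ^ (i + j).val = s * a ^ i.val * a ^ j.val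
      rw [hadd, mul_assoc]
    · change a ^ (j - i).val = s * a ^ i.val * (s * a ^ j.val)
      rw [hsub, ← mul_assoc, mul_assoc s, hconj, ← mul_assoc, hs, one_mul]

/-! ### Subgroups of `GL₂(𝔽₃)` -/

/-- The invertible matrix with the given inverse. -/
def glMk (m m' : Matrix (Fin 2) (Fin 2) (ZMod 3)) (h : m * m' = 1) (h' : m' * m = 1) :
    GL (Fin 2) (ZMod 3) := ⟨m, m', h, h'⟩

/-- The rotation is minus a unipotent matrix, of order 6; the image is the whole upper triangular
group, of order 12. -/
def borelHom : DihedralGroup 6 →* GL (Fin 2) (ZMod 3) :=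
  dihedralLift 6 (glMk !![-1, -1; 0, -1] !![-1, 1; 0, -1] (by decide) (by decide))
    (glMk !![1, 0; 0, -1] !![1, 0; 0, -1] (by decide) (by decide))
    (by decide) (by decide) (by decide)

/-- The image consists of all eight monomial matrices; the rotation squares to `-1`. -/
def monomialHom : DihedralGroup 4 →* GL (Fin 2) (ZMod 3) :=
  dihedralLift 4 (glMk !![0, -1; 1, 0] !![0, 1; -1, 0] (by decide) (by decide))
    (glMk !![1, 0; 0, -1] !![1, 0; 0, -1] (by decide) (by decide))
    (by decide) (by decide) (by decide)

theorem borelHom_injective : Function.Injective borelHom := by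
  rw [injective_iff_map_eq_one]; decide

theorem monomialHom_injective : Function.Injective monomialHom := by
  rw [injective_iff_map_eq_one]; decide

/-- The first matrix generates a copy of `𝔽₉ˣ`, and the involution acts on it as Frobenius `r ↦ r³`.
-/
def semidihedralHom : SD16 →* GL (Fin 2) (ZMod 3) :=
  SemidirectProduct.lift
    (cyclicLift 8 (glMk !![0, 1; 1, 1] !![-1, 1; 1, 0] (by decide) (by decide)) (by decide))
    (cyclicLift 2 (glMk !![1, 1; 0, -1] !![1, 1; 0, -1] (by decide) (by decide)) (by decide))
    (by
      refine fun g => MonoidHom.ext fun h => ?_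
      revert g h
      decide)

theorem semidihedralHom_injective : Function.Injective semidihedralHom := by
  rw [injective_iff_map_eq_one]
  rintro ⟨a, b⟩
  revert a b
  decide

def diagonalHom : C2 × C2 →* GL (Fin 2) (ZMod 3) :=
  (cyclicLift 2 (glMk !![-1, 0; 0, 1] !![-1, 0; 0, 1] (by decide) (by decide))
    (by decide)).noncommCoprod
  (cyclicLift 2 (glMk !![1, 0; 0, -1] !![1, 0; 0, -1] (by decide) (by decide)) (by decide))
  (by unfold Commute SemiconjBy; decide)

theorem diagonalHom_injective : Function.Injective diagonalHom := by
  rw [injective_iff_map_eq_one]; decide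

theorem GL_det_ne_zero (g : GL (Fin 2) (ZMod 3)) :
    g.1 0 0 * g.1 1 1 - g.1 0 1 * g.1 1 0 ≠ 0 := by
  rw [← Matrix.det_fin_two]
  exact ((Matrix.isUnit_iff_isUnit_det _).1 g.isUnit).ne_zero

theorem mem_range_of_coe_eq {A : Type*} [Group A] (f : A →* GL (Fin 2) (ZMod 3))
    (g : GL (Fin 2) (ZMod 3))
    (h : ∃ x, (f x).1 = !![g.1 0 0, g.1 0 1; g.1 1 0, g.1 1 1]) : g ∈ f.range := by
  obtain ⟨x, hx⟩ := h
  exact ⟨x, Units.ext (hx.trans (Matrix.eta_fin_two g.1).symm)⟩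

theorem mem_range_borelHom (g : GL (Fin 2) (ZMod 3)) (h : g.1 1 0 = 0) : g ∈ borelHom.range := by
  apply mem_range_of_coe_eq
  have := GL_det_ne_zero g
  revert this h
  generalize g.1 0 0 = a, g.1 0 1 = b, g.1 1 0 = c, g.1 1 1 = d
  revert a b c d
  decide

theorem mem_range_monomialHom (g : GL (Fin 2) (ZMod 3))
    (h : g.1 1 0 = 0 ∧ g.1 0 1 = 0 ∨ g.1 0 0 = 0 ∧ g.1 1 1 = 0) : g ∈ monomialHom.range := by
  apply mem_range_of_coe_eq
  have := GL_det_ne_zero g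
  revert this h
  generalize g.1 0 0 = a, g.1 0 1 = b, g.1 1 0 = c, g.1 1 1 = d
  revert a b c d
  decide

theorem mem_range_diagonalHom (g : GL (Fin 2) (ZMod 3)) (h : g.1 1 0 = 0) (h' : g.1 0 1 = 0) :
    g ∈ diagonalHom.range := by
  apply mem_range_of_coe_eq
  have := GL_det_ne_zero g
  revert this h h'
  generalize g.1 0 0 = a, g.1 0 1 = b, g.1 1 0 = c, g.1 1 1 = d
  revert a b c d
  decide

theorem card_GL_two_three : Nat.card (GL (Fin 2) (ZMod 3)) = 48 := by
  have : Fact (Nat.Prime 3) := ⟨Nat.prime_three⟩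
  rw [Matrix.card_GL_field]
  simp [Fin.prod_univ_two, ZMod.card]

theorem GL_neg_one_ne_one : (-1 : GL (Fin 2) (ZMod 3)) ≠ 1 := by decide

/-- Since `48 = 16 · 3`, the image of `semidihedralHom` is a Sylow 2-subgroup, and Sylow subgroups
are conjugate. -/
theorem exists_conj_semidihedralHom (H : Subgroup (GL (Fin 2) (ZMod 3))) (hH : IsPGroup 2 H) :
    ∃ g : GL (Fin 2) (ZMod 3), H ≤ ((MulAut.conj g).toMonoidHom.comp semidihedralHom).range := by
  have : Fact (Nat.Prime 2) := ⟨Nat.prime_two⟩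
  obtain ⟨Q, hQ⟩ := hH.exists_le_sylow
  have hc : Nat.card semidihedralHom.range =
      2 ^ (Nat.card (GL (Fin 2) (ZMod 3))).factorization 2 := by
    rw [← Nat.card_congr (MonoidHom.ofInjective semidihedralHom_injective).toEquiv,
      card_GL_two_three, SemidirectProduct.card, Nat.card_eq_fintype_card, Nat.card_eq_fintype_card]
    have : (48 : ℕ).factorization 2 = 4 := by
      rw [Nat.factorization_def _ Nat.prime_two]
      have : (48 : ℕ) = 2 ^ 4 * 3 := by norm_num
      rw [this, padicValNat.mul (by norm_num) (by norm_num), padicValNat.prime_pow]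
      norm_num
    rw [this]
    rfl
  obtain ⟨g, hg⟩ := MulAction.exists_smul_eq (GL (Fin 2) (ZMod 3))
    (Sylow.ofCard semidihedralHom.range hc) Q
  refine ⟨g, hQ.trans ?_⟩
  rintro x hx
  rw [← hg] at hx
  obtain ⟨y, ⟨a, rfl⟩, rfl⟩ := hx
  exact ⟨a, rfl⟩

/-! ### Subgroups of the symmetric group on four letters -/

/-- The symmetries of the partition `{0,1} | {2,3}`; the rotation is the 4-cycle `0 → 2 → 1 → 3 →
0`. -/
def dihedralPermHom : DihedralGroup 4 →* Equiv.Perm (Fin 4) :=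
  dihedralLift 4 (Equiv.swap 0 1 * Equiv.swap 0 2 * Equiv.swap 1 3) (Equiv.swap 0 1)
    (by decide) (by decide) (by decide)

theorem dihedralPermHom_injective : Function.Injective dihedralPermHom := by
  rw [injective_iff_map_eq_one]; decide

theorem mem_range_dihedralPermHom (p : Equiv.Perm (Fin 4))
    (h : p 0 = 0 ∧ p 1 = 1 ∨ p 0 = 1 ∧ p 1 = 0 ∨ p 0 = 2 ∧ p 1 = 3 ∨ p 0 = 3 ∧ p 1 = 2) :
    p ∈ dihedralPermHom.range := by
  change ∃ x, dihedralPermHom x = p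
  revert p
  decide

def kleinPermHom : C2 × C2 →* Equiv.Perm (Fin 4) :=
  (cyclicLift 2 (Equiv.swap 0 1) (by decide)).noncommCoprod
  (cyclicLift 2 (Equiv.swap 2 3) (by decide)) (by unfold Commute SemiconjBy; decide)

theorem kleinPermHom_injective : Function.Injective kleinPermHom := by
  rw [injective_iff_map_eq_one]; decide

theorem mem_range_kleinPermHom (p : Equiv.Perm (Fin 4))
    (h : p 0 = 0 ∧ p 1 = 1 ∨ p 0 = 1 ∧ p 1 = 0) : p ∈ kleinPermHom.range := by
  change ∃ x, kleinPermHom x = p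
  revert p
  decide

/-- Each subgroup of order 2 in `⟨(0 1), (2 3)⟩` fixes `0`, fixes `2`, or is even; the three
hypotheses exclude them in turn. -/
theorem kleinPermHom_range_le (H : Subgroup (Equiv.Perm (Fin 4)))
    (h : ∀ p ∈ H, p 0 = 0 ∧ p 1 = 1 ∨ p 0 = 1 ∧ p 1 = 0) (h₁ : ∃ p ∈ H, p 0 ≠ 0)
    (h₂ : ∃ p ∈ H, p 2 ≠ 2) (h₃ : ∃ p ∈ H, Equiv.Perm.sign p ≠ 1) : kleinPermHom.range ≤ H := by
  obtain ⟨p, hp, h₁⟩ := h₁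
  obtain ⟨q, hq, h₂⟩ := h₂
  obtain ⟨r, hr, h₃⟩ := h₃
  have key : ∀ p : Equiv.Perm (Fin 4), p 0 = 0 ∧ p 1 = 1 ∨ p 0 = 1 ∧ p 1 = 0 →
      p = 1 ∨ p = Equiv.swap 0 1 ∨ p = Equiv.swap 2 3 ∨ p = Equiv.swap 0 1 * Equiv.swap 2 3 := by
    decide
  have gen : Equiv.swap 0 1 ∈ H ∧ Equiv.swap 2 3 ∈ H := by
    have h1 : p = Equiv.swap 0 1 ∨ p = Equiv.swap 0 1 * Equiv.swap 2 3 := by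
      revert h₁; rcases key p (h p hp) with rfl | rfl | rfl | rfl <;> decide
    have h2 : q = Equiv.swap 2 3 ∨ q = Equiv.swap 0 1 * Equiv.swap 2 3 := by
      revert h₂; rcases key q (h q hq) with rfl | rfl | rfl | rfl <;> decide
    have h3 : r = Equiv.swap 0 1 ∨ r = Equiv.swap 2 3 := by
      revert h₃; rcases key r (h r hr) with rfl | rfl | rfl | rfl <;> decide
    rcases h3 with rfl | rfl
    · refine ⟨hr, ?_⟩
      rcases h2 with rfl | rfl
      · exact hq
      · exact (H.mul_mem_cancel_left hr).1 hq
    · refine ⟨?_, hr⟩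
      rcases h1 with rfl | rfl
      · exact hp
      · exact (H.mul_mem_cancel_right hr).1 hp
  rintro _ ⟨⟨a, b⟩, rfl⟩
  exact H.mul_mem (H.pow_mem gen.1 _) (H.pow_mem gen.2 _)

theorem card_eq_two_of_fixed (H : Subgroup (Equiv.Perm (Fin 4)))
    (h : ∀ p ∈ H, p 0 = 0 ∧ p 1 = 1) (h₃ : ∃ p ∈ H, Equiv.Perm.sign p ≠ 1) :
    Nat.card H = 2 := by
  obtain ⟨r, hr, h₃⟩ := h₃
  have key : ∀ p : Equiv.Perm (Fin 4), p 0 = 0 ∧ p 1 = 1 → p = 1 ∨ p = Equiv.swap 2 3 := by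
    decide
  have : H = Subgroup.zpowers (Equiv.swap 2 3) := by
    apply le_antisymm
    · intro p hp
      rcases key p (h p hp) with rfl | rfl
      · exact one_mem _
      · exact Subgroup.mem_zpowers _
    · rw [Subgroup.zpowers_le]
      rcases key r (h r hr) with rfl | rfl
      · exact absurd (by simp) h₃
      · exact hr
  rw [this, Nat.card_zpowers]
  exact orderOf_eq_prime (by decide) (by decide)

/-- The embedding of `S₃` into `S₄` as the stabilizer of `0`. -/
def stabilizerHom : Equiv.Perm (Fin 3) →* Equiv.Perm (Fin 4) where
  toFun e := Equiv.Perm.decomposeFin.symm (0, e)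
  map_one' := by decide
  map_mul' := by decide

theorem stabilizerHom_injective : Function.Injective stabilizerHom := by
  rw [injective_iff_map_eq_one]; decide

theorem mem_range_stabilizerHom (p : Equiv.Perm (Fin 4)) (h : p 0 = 0) :
    p ∈ stabilizerHom.range := by
  change ∃ x, stabilizerHom x = p
  revert p
  decide

theorem two_dvd_card_of_sign (H : Subgroup (Equiv.Perm (Fin 4)))
    (h : ∃ p ∈ H, Equiv.Perm.sign p ≠ 1) : 2 ∣ Nat.card H := by
  obtain ⟨p, hp, h⟩ := h
  have h1 : orderOf (Equiv.Perm.sign p) = 2 :=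
    orderOf_eq_prime (by rw [pow_two, Int.units_mul_self]) h
  have h2 : orderOf (Equiv.Perm.sign p) ∣ orderOf p := orderOf_map_dvd _ p
  rw [h1] at h2
  exact h2.trans (Subgroup.orderOf_dvd_natCard H hp)

theorem card_of_stabilizer (H : Subgroup (Equiv.Perm (Fin 4))) (h : ∀ p ∈ H, p 0 = 0)
    (h₂ : ∃ p ∈ H, Equiv.Perm.sign p ≠ 1) (h₃ : 3 ∣ Nat.card H) : Nat.card H = 6 := by
  have h6 : 6 ∣ Nat.card H :=
    Nat.Coprime.mul_dvd_of_dvd_of_dvd (by norm_num : Nat.Coprime 2 3) (two_dvd_card_of_sign H h₂) h₃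
  have hle : H ≤ stabilizerHom.range := fun p hp => mem_range_stabilizerHom p (h p hp)
  have hc : Nat.card stabilizerHom.range = 6 := by
    rw [← Nat.card_congr (MonoidHom.ofInjective stabilizerHom_injective).toEquiv,
      Nat.card_eq_fintype_card]
    decide
  have := Subgroup.card_dvd_of_le hle
  rw [hc] at this
  exact Nat.dvd_antisymm this h6

/-- A 3-cycle is transitive on three letters, so the lack of a common fixed point makes `H`
transitive and `12 ∣ |H|`. The only subgroup of index 2 is `A₄`, which the odd element excludes. -/
theorem eq_top_of_fixed_point_free (H : Subgroup (Equiv.Perm (Fin 4)))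
    (h : ∀ i, ∃ p ∈ H, p i ≠ i) (h₂ : ∃ p ∈ H, Equiv.Perm.sign p ≠ 1)
    (h₃ : 3 ∣ Nat.card H) : H = ⊤ := by
  have : Fact (Nat.Prime 3) := ⟨Nat.prime_three⟩
  obtain ⟨⟨c, hcH⟩, hc⟩ := exists_prime_orderOf_dvd_card' 3 h₃
  rw [Subgroup.orderOf_mk] at hc
  have hc3 : c ^ 3 = 1 := hc ▸ pow_orderOf_eq_one c
  have hc1 : c ≠ 1 := by rintro rfl; simp at hc
  have hcard : Nat.card (Equiv.Perm (Fin 4)) = 24 := by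
    rw [Nat.card_eq_fintype_card]; decide
  have htrans : ∀ i, ∃ q ∈ H, q i = 0 := by
    have key : ∀ c : Equiv.Perm (Fin 4), c ^ 3 = 1 → c ≠ 1 → ∃ j, c j = j ∧
        ∀ i k, i ≠ j → k ≠ j → i = k ∨ c i = k ∨ c (c i) = k := by decide
    obtain ⟨j, hj, hcyc⟩ := key c hc3 hc1
    have hcyc' : ∀ i k, i ≠ j → k ≠ j → ∃ q ∈ H, q i = k := by
      intro i k hi hk
      rcases hcyc i k hi hk with h | h | h
      · exact ⟨1, one_mem _, h⟩
      · exact ⟨c, hcH, h⟩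
      · exact ⟨c * c, mul_mem hcH hcH, h⟩
    -- An element moving `j`, the fixed letter of the 3-cycle, joins it to the orbit of the other
    -- three.
    obtain ⟨p, hp, hpj⟩ := h j
    have toj : ∀ i, ∃ q ∈ H, q i = j := by
      intro i
      by_cases hi : i = j
      · exact ⟨1, one_mem _, hi⟩
      · obtain ⟨q, hq, hqi⟩ := hcyc' i (p j) hi hpj
        exact ⟨p⁻¹ * q, mul_mem (inv_mem hp) hq, by simp [hqi]⟩
    obtain ⟨q₀, hq₀, hq₀j⟩ := toj 0
    intro i
    obtain ⟨q, hq, hqi⟩ := toj i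
    refine ⟨q₀⁻¹ * q, mul_mem (inv_mem hq₀) hq, ?_⟩
    rw [Equiv.Perm.mul_apply, hqi, Equiv.Perm.inv_eq_iff_eq, hq₀j]
  have h4 : 4 ∣ Nat.card H := by
    have htr : MulAction.orbit H (0 : Fin 4) = Set.univ := by
      refine Set.eq_univ_of_forall fun i => ?_
      obtain ⟨q, hq, hqi⟩ := htrans i
      refine ⟨⟨q⁻¹, inv_mem hq⟩, ?_⟩
      change q⁻¹ 0 = i
      rw [Equiv.Perm.inv_eq_iff_eq, hqi]
    have h1 := MulAction.index_stabilizer H (0 : Fin 4)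
    rw [htr, Set.ncard_univ, Nat.card_eq_fintype_card, Fintype.card_fin] at h1
    have h2 := Subgroup.index_dvd_card (MulAction.stabilizer H (0 : Fin 4))
    rwa [h1] at h2
  have h12 : 12 ∣ Nat.card H :=
    Nat.Coprime.mul_dvd_of_dvd_of_dvd (by norm_num : Nat.Coprime 4 3) h4 h₃
  have hmul := H.card_mul_index
  rw [hcard] at hmul
  obtain ⟨k, hk⟩ := h12
  rw [hk] at hmul
  have hi : k * H.index = 2 := by linarith
  have hi2 : H.index ∣ 2 := Dvd.intro_left _ hi
  rcases (Nat.dvd_prime Nat.prime_two).1 hi2 with h | h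
  · exact Subgroup.index_eq_one.1 h
  · exfalso
    obtain ⟨p, hp, hs⟩ := h₂
    rw [Equiv.Perm.eq_alternatingGroup_of_index_eq_two h, Equiv.Perm.mem_alternatingGroup] at hp
    exact hs hp

/-- `H` lies in a dihedral group of order 8, and groups of order 1, 2 and 4 are commutative. -/
theorem card_of_noncomm (H : Subgroup (Equiv.Perm (Fin 4)))
    (h : ∀ p ∈ H, p 0 = 0 ∧ p 1 = 1 ∨ p 0 = 1 ∧ p 1 = 0 ∨ p 0 = 2 ∧ p 1 = 3 ∨ p 0 = 3 ∧ p 1 = 2)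
    (h₂ : ∃ p ∈ H, ∃ q ∈ H, p * q ≠ q * p) : Nat.card H = 8 := by
  have : Fact (Nat.Prime 2) := ⟨Nat.prime_two⟩
  have hle : H ≤ dihedralPermHom.range := fun p hp => mem_range_dihedralPermHom p (h p hp)
  have hc : Nat.card dihedralPermHom.range = 2 ^ 3 := by
    rw [← Nat.card_congr (MonoidHom.ofInjective dihedralPermHom_injective).toEquiv,
      DihedralGroup.nat_card]
    norm_num
  have hd := Subgroup.card_dvd_of_le hle
  rw [hc] at hd
  obtain ⟨k, hk, hHk⟩ := (Nat.dvd_prime_pow Nat.prime_two).1 hd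
  obtain ⟨p, hp, q, hq, hpq⟩ := h₂
  have hnc : ¬ ∀ a b : H, a * b = b * a := fun hcomm =>
    hpq (congrArg Subtype.val (hcomm ⟨p, hp⟩ ⟨q, hq⟩))
  interval_cases k
  · exfalso
    have := (Nat.card_eq_one_iff_unique.1 (hHk.trans (pow_zero 2))).1
    exact hnc fun a b => Subsingleton.elim _ _
  · exfalso
    have := isCyclic_of_prime_card (α := H) (p := 2) (hHk.trans (pow_one 2))
    exact hnc (IsCyclic.isMulCommutative (α := H)).is_comm.comm
  · exfalso
    exact hnc (IsPGroup.isMulCommutative_of_card_eq_prime_sq (p := 2) hHk).is_comm.comm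
  · simpa using hHk

/-! ### Rational parametrizations -/

theorem F₁_F₂_eq {k : Type*} [Field k] {t : k} (ht : t ≠ 0) :
    F₁ (F₂ t) = G₁ (G₂ (G₃ t)) := by
  simp only [F₁, F₂, G₁, G₂, G₃]
  field_simp
  ring

theorem F₁_F₂_image : F₁ '' (F₂ '' ratStar) = G₁ '' (G₂ '' (G₃ '' ratStar)) := by
  simp only [Set.image_image]
  exact Set.image_congr fun t ht => F₁_F₂_eq ht

/-- This is the irrationality of `√3`, in the form suited to `t² - 18t - 27 = (t - 9)² - 12 · 3²`.
-/
theorem not_isSquare_twelve_mul {x : ℚ} (a : ℚ) (h : x ^ 2 = 12 * a ^ 2) : a = 0 := by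
  by_contra ha
  have h1 : (x / (2 * a)) ^ 2 = 3 := by
    field_simp
    linarith
  have h2 : ¬ IsSquare (3 : ℚ) := by
    rw [show (3 : ℚ) = ((3 : ℕ) : ℚ) by norm_num, Rat.isSquare_natCast_iff]
    exact Nat.prime_three.prime.not_isSquare
  exact h2 ⟨x / (2 * a), by rw [← pow_two, h1]⟩

section Parametrizations

variable {c₄ c₆ D : ℚ} (hrel : 1728 * D = c₄ ^ 3 - c₆ ^ 2) (hD : D ≠ 0) (hc₄ : c₄ ≠ 0)
include hrel hD hc₄

/-- The parameter and the root are linked by `x² = 9c₄(t + 1)/(t + 9)`. Given `t`, the quartic is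
linear in `c₆x` once `x²` is known, so `x` itself is rational. -/
theorem mem_F₁_image_iff :
    c₄ ^ 3 / D ∈ F₁ '' ratStar ↔ ∃ x : ℚ, x ^ 4 - 6 * c₄ * x ^ 2 - 8 * c₆ * x - 3 * c₄ ^ 2 = 0 := by
  constructor
  · rintro ⟨t, ht, h⟩
    change t ≠ 0 at ht
    have h' : 27 * ((t + 1) * (t + 9) ^ 3) * D = c₄ ^ 3 * t ^ 3 := by
      simp only [F₁] at h
      field_simp at h
      linarith
    have hne : (t + 1) * (t + 9) ^ 3 ≠ 0 := fun h0 => by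
      rw [h0] at h'
      exact mul_ne_zero (pow_ne_zero 3 hc₄) (pow_ne_zero 3 ht) (by linarith)
    have h9 : t + 9 ≠ 0 := fun h0 => hne (by rw [h0]; ring)
    have hq : t ^ 2 - 18 * t - 27 ≠ 0 := fun h0 => by
      have := not_isSquare_twelve_mul (x := t - 9) 3 (by linear_combination h0)
      norm_num at this
    have hc₆sq : c₆ ^ 2 * ((t + 1) * (t + 9) ^ 3) = c₄ ^ 3 * (t ^ 2 - 18 * t - 27) ^ 2 := by
      linear_combination ((t + 1) * (t + 9) ^ 3) * hrel - 64 * h'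
    have hc₆ : c₆ ≠ 0 := fun h0 => by
      rw [h0] at hc₆sq
      exact mul_ne_zero (pow_ne_zero 3 hc₄) (pow_ne_zero 2 hq) (by linarith)
    -- The solution of `8c₆x = x⁴ - 6c₄x² - 3c₄²` after inserting `x² = 9c₄(t + 1)/(t + 9)` on the
    -- right.
    refine ⟨3 * c₄ ^ 2 * (t ^ 2 - 18 * t - 27) / (c₆ * (t + 9) ^ 2), ?_⟩
    set x := 3 * c₄ ^ 2 * (t ^ 2 - 18 * t - 27) / (c₆ * (t + 9) ^ 2) with hx
    have h1 : c₆ * x * (t + 9) ^ 2 = 3 * c₄ ^ 2 * (t ^ 2 - 18 * t - 27) := by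
      rw [hx]; field_simp
    have h2 : x ^ 2 * (t + 9) = 9 * c₄ * (t + 1) := by
      have : c₆ ^ 2 * (t + 9) ^ 3 * (x ^ 2 * (t + 9) - 9 * c₄ * (t + 1)) = 0 := by
        linear_combination (c₆ * x * (t + 9) ^ 2 + 3 * c₄ ^ 2 * (t ^ 2 - 18 * t - 27)) * h1
          - 9 * c₄ * hc₆sq
      have hne' : c₆ ^ 2 * (t + 9) ^ 3 ≠ 0 := mul_ne_zero (pow_ne_zero 2 hc₆) (pow_ne_zero 3 h9)
      linarith [(mul_eq_zero.1 this).resolve_left hne']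
    have h3 : (t + 9) ^ 2 * (x ^ 4 - 6 * c₄ * x ^ 2 - 8 * c₆ * x - 3 * c₄ ^ 2) = 0 := by
      linear_combination (x ^ 2 * (t + 9) + 9 * c₄ * (t + 1) - 6 * c₄ * (t + 9)) * h2 - 8 * h1
    exact (mul_eq_zero.1 h3).resolve_left (pow_ne_zero 2 h9)
  · rintro ⟨x, hx⟩
    have hx0 : x ≠ 0 := fun h0 => by
      rw [h0] at hx
      exact pow_ne_zero 2 hc₄ (by linarith)
    -- Multiplying the quartic by its value at `-x` leaves only `c₆²`, which `hrel` eliminates.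
    have hDx : 64 * 1728 * x ^ 2 * D = -((c₄ - x ^ 2) ^ 3 * (9 * c₄ - x ^ 2)) := by
      linear_combination 64 * x ^ 2 * hrel +
        (x ^ 4 - 6 * c₄ * x ^ 2 - 3 * c₄ ^ 2 + 8 * c₆ * x) * hx
    have hne : (c₄ - x ^ 2) ^ 3 * (9 * c₄ - x ^ 2) ≠ 0 := fun h0 => by
      rw [h0, neg_zero] at hDx
      exact mul_ne_zero (mul_ne_zero (by norm_num) (pow_ne_zero 2 hx0)) hD hDx
    have h1 : x ^ 2 - c₄ ≠ 0 := fun h0 => hne (by rw [← neg_sub, h0]; ring)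
    have h2 : 9 * c₄ - x ^ 2 ≠ 0 := fun h0 => hne (by rw [h0]; ring)
    refine ⟨9 * (x ^ 2 - c₄) / (9 * c₄ - x ^ 2), div_ne_zero (mul_ne_zero (by norm_num) h1) h2, ?_⟩
    have hD' : D = (x ^ 2 - c₄) ^ 3 * (9 * c₄ - x ^ 2) / (64 * 1728 * x ^ 2) := by
      rw [eq_div_iff (by positivity)]
      linear_combination hDx
    have e1 : 9 * (x ^ 2 - c₄) / (9 * c₄ - x ^ 2) + 1 = 8 * x ^ 2 / (9 * c₄ - x ^ 2) := by
      field_simp; ring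
    have e2 : 9 * (x ^ 2 - c₄) / (9 * c₄ - x ^ 2) + 9 = 72 * c₄ / (9 * c₄ - x ^ 2) := by
      field_simp; ring
    rw [F₁, e1, e2, hD']
    field_simp
    norm_num

omit hrel in
theorem mem_G₁_image_iff : c₄ ^ 3 / D ∈ G₁ '' ratStar ↔ ∃ δ : ℚ, δ ^ 3 = D := by
  constructor
  · rintro ⟨t, ht, h⟩
    change t ≠ 0 at ht
    refine ⟨c₄ / t, ?_⟩
    simp only [G₁] at h
    rw [div_pow, h]
    field_simp
  · rintro ⟨δ, hδ⟩
    have h0 : δ ≠ 0 := by rintro rfl; exact hD (by rw [← hδ]; ring)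
    exact ⟨c₄ / δ, div_ne_zero hc₄ h0, by rw [G₁, div_pow, hδ]⟩

omit hrel in
-- With `t = c₄/δ`, the equation `G₂ u = t` reads `u² - (2 + t/3)u - 3 = 0`, of discriminant `(t² +
-- 12t + 144)/9`.
theorem mem_G₁_G₂_image_iff : c₄ ^ 3 / D ∈ G₁ '' (G₂ '' ratStar) ↔
    ∃ δ n : ℚ, δ ^ 3 = D ∧ n ^ 2 = c₄ ^ 2 + 12 * c₄ * δ + 144 * δ ^ 2 := by
  constructor
  · rintro ⟨_, ⟨u, hu, rfl⟩, h⟩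
    change u ≠ 0 at hu
    simp only [G₁] at h
    have ht : G₂ u ≠ 0 := fun h0 => by
      rw [h0] at h
      exact div_ne_zero (pow_ne_zero 3 hc₄) hD (by rw [← h]; ring)
    -- `n` is `3δ` times the difference of the two roots `u` and `-3/u`.
    refine ⟨c₄ / G₂ u, c₄ / G₂ u * (3 * (u ^ 2 + 3) / u), ?_, ?_⟩
    · rw [div_pow, h]
      field_simp
    · have hG : u * G₂ u = 3 * (u + 1) * (u - 3) := by rw [G₂]; field_simp
      field_simp
      linear_combination -(u * G₂ u + 3 * (u + 1) * (u - 3) + 12 * u) * hG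
  · rintro ⟨δ, n, hδ, hn⟩
    have h0 : δ ≠ 0 := by rintro rfl; exact hD (by rw [← hδ]; ring)
    have hu : ((6 * δ + c₄ + n) / (6 * δ)) * ((6 * δ + c₄ + n) / (6 * δ)
        - (2 + c₄ / (3 * δ))) = 3 := by
      field_simp
      linear_combination 3 * hn
    have hu0 : (6 * δ + c₄ + n) / (6 * δ) ≠ 0 := fun h => by rw [h] at hu; norm_num at hu
    refine ⟨_, ⟨_, hu0, rfl⟩, ?_⟩
    have : G₂ ((6 * δ + c₄ + n) / (6 * δ)) = c₄ / δ := by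
      set u := (6 * δ + c₄ + n) / (6 * δ)
      rw [G₂, div_eq_iff hu0]
      have : c₄ / δ = 3 * (c₄ / (3 * δ)) := by field_simp
      rw [this]
      linear_combination 3 * hu
    rw [G₁, this, div_pow, hδ]

end Parametrizations

/-- `F₁ t` is `t + 1` times a cube, so `t + 1 = w³`, and `F₂ (w - 1) = w³ - 1`. -/
theorem mem_F₁_F₂_image {j : ℚ} (hj : j ≠ 0) (h₁ : j ∈ F₁ '' ratStar) (h₂ : j ∈ G₁ '' ratStar) :
    j ∈ F₁ '' (F₂ '' ratStar) := by
  obtain ⟨t, ht, rfl⟩ := h₁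
  obtain ⟨s, hs, h⟩ := h₂
  change t ≠ 0 at ht
  simp only [F₁, G₁] at h
  have h9 : t + 9 ≠ 0 := fun h0 => hj (by rw [F₁, h0]; simp)
  have hw : (s * t / (3 * (t + 9))) ^ 3 = t + 1 := by
    have : s ^ 3 * t ^ 3 = 27 * ((t + 1) * (t + 9) ^ 3) := by
      rw [h]; field_simp
    field_simp
    linear_combination this
  set w := s * t / (3 * (t + 9))
  refine ⟨t, ⟨w - 1, fun h0 => ht ?_, ?_⟩, rfl⟩
  · have : w = 1 := by linarith
    rw [this] at hw
    linarith
  · rw [F₂]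
    linear_combination hw

/-! ### Galois groups via homomorphisms from the absolute Galois group -/

/-- The algebraic closure of `ℚ`. -/
abbrev QBar : Type := AlgebraicClosure ℚ

/-- Two `ℚ`-algebra structures on `QBar` occur; they agree because a ring carries at most one. -/
instance isAlgClosure_QBar : IsAlgClosure ℚ QBar := by
  have h : @IsAlgClosure ℚ QBar _ _ (AlgebraicClosure.instAlgebra ℚ) _ := inferInstance
  exact Subsingleton.elim
    (AlgebraicClosure.instAlgebra ℚ) (DivisionRing.toRatAlgebra : Algebra ℚ QBar) ▸ h

instance isGalois_QBar : IsGalois ℚ QBar := by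
  have : Algebra.IsAlgebraic ℚ QBar := IsAlgClosure.isAlgebraic
  have : Normal ℚ QBar := IsAlgClosure.normal ℚ QBar
  constructor

/-- The absolute Galois group of `ℚ`. -/
abbrev GalQ : Type := QBar ≃ₐ[ℚ] QBar

theorem mem_fixingSubgroup_adjoin_iff (S : Set QBar) (σ : GalQ) :
    σ ∈ (IntermediateField.adjoin ℚ S).fixingSubgroup ↔ ∀ x ∈ S, σ x = x := by
  rw [← Subgroup.zpowers_le, ← IntermediateField.le_iff_le, IntermediateField.adjoin_le_iff]
  constructor
  · intro h x hx
    exact h hx ⟨σ, Subgroup.mem_zpowers σ⟩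
  · rintro h x hx ⟨τ, hτ⟩
    have : Subgroup.zpowers σ ≤ MulAction.stabilizer _ x := by
      rw [Subgroup.zpowers_le]
      exact h x hx
    exact this hτ

/-- A normal fixing subgroup makes `L` Galois; restriction to `L` and `φ` then have the same kernel,
hence isomorphic images. -/
theorem hasGaloisGroup_of_hom (L : IntermediateField ℚ QBar) {M : Type*} [Group M]
    (φ : GalQ →* M) (hker : φ.ker = L.fixingSubgroup)
    {Γ : Type} [Group Γ] (e : Nonempty (φ.range ≃* Γ)) : HasGaloisGroup L Γ := by
  have hn : L.fixingSubgroup.Normal := hker ▸ φ.normal_ker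
  have h : ∃ a : Algebra ℚ L, IsGalois ℚ L ∧ Nonempty ((L ≃ₐ[ℚ] L) ≃* Γ) := by
    refine ⟨L.algebra', ?_⟩
    have hg := (InfiniteGalois.normal_iff_isGalois L).1 hn
    have : Normal ℚ L := hg.to_normal
    obtain ⟨e⟩ := e
    have h := IntermediateField.restrictNormalHom_ker L
    rw [← hker] at h
    refine ⟨hg, ⟨?_⟩⟩
    refine MulEquiv.trans ?_ e
    exact (QuotientGroup.quotientKerEquivOfSurjective _
        (AlgEquiv.restrictNormalHom_surjective (F := ℚ) (K₁ := L) QBar)).symm.trans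
      ((QuotientGroup.quotientMulEquivOfEq h).trans (QuotientGroup.quotientKerEquivRange φ))
  obtain ⟨a, h⟩ := h
  rwa [Subsingleton.elim a DivisionRing.toRatAlgebra] at h

theorem exists_rat_of_fixed {x : QBar} (h : ∀ σ : GalQ, σ x = x) :
    ∃ q : ℚ, algebraMap ℚ QBar q = x :=
  (InfiniteGalois.mem_range_algebraMap_iff_fixed x).2 h

/-- `ℚ(δ)` has degree 3, and its fixing subgroup, of index 3, contains the kernel of `φ`. -/
theorem three_dvd_of_cube_root {M : Type*} [Group M] (φ : GalQ →* M) {D : ℚ}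
    (hD : ∀ b : ℚ, b ^ 3 ≠ D) {δ : QBar} (hδ : δ ^ 3 = algebraMap ℚ QBar D)
    (hfix : ∀ σ, φ σ = 1 → σ δ = δ) : 3 ∣ Nat.card φ.range := by
  have hirr : Irreducible (X ^ 3 - C D : ℚ[X]) :=
    X_pow_sub_C_irreducible_of_prime Nat.prime_three hD
  have hroot : aeval δ (X ^ 3 - C D : ℚ[X]) = 0 := by simp [hδ]
  have hmin : minpoly ℚ δ = X ^ 3 - C D :=
    (minpoly.eq_of_irreducible_of_monic hirr hroot (monic_X_pow_sub_C D three_ne_zero)).symm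
  have hdeg := IntermediateField.adjoin.finrank (Algebra.IsIntegral.isIntegral (R := ℚ) δ)
  rw [hmin, natDegree_X_pow_sub_C, IntermediateField.finrank_eq_fixingSubgroup_index] at hdeg
  have hle : φ.ker ≤ (IntermediateField.adjoin ℚ {δ}).fixingSubgroup := fun σ hσ => by
    rw [mem_fixingSubgroup_adjoin_iff]
    rintro x rfl
    exact hfix σ hσ
  rw [← Subgroup.index_ker, ← hdeg]
  exact Subgroup.index_dvd_of_le hle

theorem map_eq_or_eq_neg {x : QBar} {a : ℚ} (hx : x ^ 2 = a) (σ : GalQ) : σ x = x ∨ σ x = -x := by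
  apply sq_eq_sq_iff_eq_or_eq_neg.1
  rw [← map_pow, hx, map_ratCast]

theorem exists_map_eq_and_map_eq_neg {x y : QBar} {a b : ℚ} (hx : x ^ 2 = a) (hy : y ^ 2 = b)
    (hb : ¬ IsSquare b) (hab : ¬ IsSquare (a * b)) : ∃ σ : GalQ, σ x = x ∧ σ y = -y := by
  by_contra! hcon
  have h1 : ∀ σ : GalQ, σ x = x → σ y = y := fun σ h =>
    (map_eq_or_eq_neg hy σ).resolve_right (hcon σ h)
  have hnot {u : QBar} {c : ℚ} (hu : u ^ 2 = c) (hc : ¬ IsSquare c) : ∃ σ : GalQ, σ u ≠ u := by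
    by_contra! h
    obtain ⟨q, hq⟩ := exists_rat_of_fixed h
    refine hc ⟨q, ?_⟩
    rw [← hq, eq_ratCast] at hu
    exact_mod_cast (by rw [← hu]; ring : (c : QBar) = q * q)
  -- If fixing `x` implied fixing `y`, then `τ` would negate both. For any `σ` negating `x`, the
  -- product `τσ` fixes `x`, hence `y`, so `σ` negates `y`. Thus `xy` would be rational.
  obtain ⟨τ, hτ⟩ := hnot hy hb
  have hτy := (map_eq_or_eq_neg hy τ).resolve_left hτ
  have hτx := (map_eq_or_eq_neg hx τ).resolve_left fun h => hτ (h1 τ h)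
  obtain ⟨σ, hσ⟩ := hnot (u := x * y) (c := a * b) (by rw [mul_pow, hx, hy]; push_cast; ring) hab
  apply hσ
  rw [map_mul]
  rcases map_eq_or_eq_neg hx σ with h | h
  · rw [h, h1 σ h]
  · have h2 := h1 (τ * σ) (by rw [AlgEquiv.mul_apply, h, map_neg, hτx, neg_neg])
    rcases map_eq_or_eq_neg hy σ with h3 | h3
    · rw [AlgEquiv.mul_apply, h3] at h2
      exact absurd h2 hτ
    · rw [h, h3, neg_mul_neg]

/-! ### The roots of the `3`-division polynomial -/

/-- The resolvent data of the quartic `x⁴ - 6 c₄ x² - 8 c₆ x - 3 c₄²`. -/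
structure RootData (c₄ c₆ D : ℚ) where
  δ : QBar
  ζ : QBar
  s₁ : QBar
  s₂ : QBar
  s₃ : QBar
  rel : 1728 * D = c₄ ^ 3 - c₆ ^ 2
  ne_zero : D ≠ 0
  δ_pow : δ ^ 3 = D
  ζ_rel : ζ ^ 2 + ζ + 1 = 0
  s₁_sq : s₁ ^ 2 = c₄ - 12 * δ
  s₂_sq : s₂ ^ 2 = c₄ - 12 * (ζ * δ)
  s₃_sq : s₃ ^ 2 = c₄ - 12 * (ζ ^ 2 * δ)
  prod : s₁ * s₂ * s₃ = c₆

/-- The quartic whose roots are the values of `12 x + b₂` at the `3`-torsion points. -/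
def quartic (c₄ c₆ : ℚ) (x : QBar) : QBar := x ^ 4 - 6 * c₄ * x ^ 2 - 8 * c₆ * x - 3 * c₄ ^ 2

namespace RootData

variable {c₄ c₆ D : ℚ} (d : RootData c₄ c₆ D)

/-- Even sign changes preserve `s₁s₂s₃ = c₆`, so these four sums satisfy the same quartic. -/
def root : Fin 4 → QBar :=
  ![d.s₁ + d.s₂ + d.s₃, d.s₁ - d.s₂ - d.s₃, -d.s₁ + d.s₂ - d.s₃, -d.s₁ - d.s₂ + d.s₃]

theorem root_zero : d.root 0 = d.s₁ + d.s₂ + d.s₃ := rfl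
theorem root_one : d.root 1 = d.s₁ - d.s₂ - d.s₃ := rfl
theorem root_two : d.root 2 = -d.s₁ + d.s₂ - d.s₃ := rfl
theorem root_three : d.root 3 = -d.s₁ - d.s₂ + d.s₃ := rfl

theorem quartic_eq_prod (x : QBar) : quartic c₄ c₆ x =
    (x - d.root 0) * (x - d.root 1) * (x - d.root 2) * (x - d.root 3) := by
  have h1 : d.s₁ ^ 2 + d.s₂ ^ 2 + d.s₃ ^ 2 = 3 * c₄ := by
    rw [d.s₁_sq, d.s₂_sq, d.s₃_sq]
    linear_combination -12 * d.δ * d.ζ_rel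
  have h2 : d.s₁ ^ 2 * d.s₂ ^ 2 + d.s₁ ^ 2 * d.s₃ ^ 2 + d.s₂ ^ 2 * d.s₃ ^ 2 = 3 * c₄ ^ 2 := by
    rw [d.s₁_sq, d.s₂_sq, d.s₃_sq]
    linear_combination (-24 * c₄ * d.δ + 144 * d.δ ^ 2 * d.ζ) * d.ζ_rel
  rw [quartic, root_zero, root_one, root_two, root_three]
  linear_combination 2 * x ^ 2 * h1 + 8 * x * d.prod
    - (d.s₁ ^ 2 + d.s₂ ^ 2 + d.s₃ ^ 2 + 3 * c₄) * h1 + 4 * h2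

theorem quartic_eq_zero_iff (x : QBar) : quartic c₄ c₆ x = 0 ↔ ∃ i, d.root i = x := by
  rw [d.quartic_eq_prod, mul_eq_zero, mul_eq_zero, mul_eq_zero, sub_eq_zero, sub_eq_zero,
    sub_eq_zero, sub_eq_zero, Fin.exists_fin_succ, Fin.exists_fin_succ, Fin.exists_fin_two]
  simp only [eq_comm (a := x), or_assoc]
  rfl

theorem δ_ne_zero : d.δ ≠ 0 := fun h => d.ne_zero (by
  have := d.δ_pow
  rw [h, zero_pow three_ne_zero] at this
  exact_mod_cast this.symm)

/-- The left side is the Vandermonde product of the roots, whose six differences are `±2(sᵢ ± sⱼ)`;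
on the right `2ζ + 1` is a square root of `-3`. -/
theorem discr_sqrt : 64 * ((d.s₁ ^ 2 - d.s₂ ^ 2) * (d.s₁ ^ 2 - d.s₃ ^ 2) * (d.s₂ ^ 2 - d.s₃ ^ 2)) =
    ((-64 * 1728 * 3 * D : ℚ) : QBar) * (2 * d.ζ + 1) := by
  rw [d.s₁_sq, d.s₂_sq, d.s₃_sq]
  push_cast
  rw [← d.δ_pow]
  linear_combination (64 * 1728 * d.δ ^ 3) * (d.ζ ^ 3 - 3 * d.ζ ^ 2 + 2 * d.ζ + 3) * d.ζ_rel

include d in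
theorem discr_const_ne_zero : ((-64 * 1728 * 3 * D : ℚ) : QBar) ≠ 0 :=
  Rat.cast_ne_zero.2 (mul_ne_zero (by norm_num) d.ne_zero)

theorem sqrt_ne_zero : (2 * d.ζ + 1) ≠ 0 := fun h => by
  have : (3 : QBar) = 0 := by linear_combination 4 * d.ζ_rel - (2 * d.ζ + 1) * h
  norm_num at this

theorem sqrt_sq : (2 * d.ζ + 1) ^ 2 = ((-3 : ℚ) : QBar) := by
  push_cast
  linear_combination 4 * d.ζ_rel

theorem det_vandermonde_root :
    (Matrix.vandermonde d.root).det = ((-64 * 1728 * 3 * D : ℚ) : QBar) * (2 * d.ζ + 1) := by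
  rw [← d.discr_sqrt, Matrix.det_vandermonde]
  simp [Fin.prod_univ_succ, Fin.prod_Ioi_succ, root]
  ring

theorem root_injective : Function.Injective d.root := by
  rw [← Matrix.det_vandermonde_ne_zero_iff, det_vandermonde_root]
  exact mul_ne_zero d.discr_const_ne_zero d.sqrt_ne_zero

theorem map_quartic (σ : GalQ) (x : QBar) : σ (quartic c₄ c₆ x) = quartic c₄ c₆ (σ x) := by
  simp only [quartic, map_sub, map_mul, map_pow, map_ratCast, map_ofNat]

theorem exists_root_eq_map (σ : GalQ) (i : Fin 4) : ∃ j, d.root j = σ (d.root i) := by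
  rw [← d.quartic_eq_zero_iff, ← map_quartic, (d.quartic_eq_zero_iff _).2 ⟨i, rfl⟩, map_zero]

theorem det_ne_zero :
    (d.s₁ ^ 2 - d.s₂ ^ 2) * (d.s₁ ^ 2 - d.s₃ ^ 2) * (d.s₂ ^ 2 - d.s₃ ^ 2) ≠ 0 := fun h => by
  have h1 := d.discr_sqrt
  rw [h, mul_zero, zero_eq_mul] at h1
  exact h1.elim d.discr_const_ne_zero d.sqrt_ne_zero

def permFun (σ : GalQ) (i : Fin 4) : Fin 4 := (d.exists_root_eq_map σ i).choose

theorem root_permFun (σ : GalQ) (i : Fin 4) : d.root (d.permFun σ i) = σ (d.root i) :=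
  (d.exists_root_eq_map σ i).choose_spec

theorem permFun_mul (σ τ : GalQ) (i : Fin 4) :
    d.permFun (σ * τ) i = d.permFun σ (d.permFun τ i) := d.root_injective <| by
  rw [root_permFun, root_permFun, root_permFun, AlgEquiv.mul_apply]

theorem permFun_one (i : Fin 4) : d.permFun 1 i = i := d.root_injective <| by
  rw [root_permFun, AlgEquiv.one_apply]

/-- The action of the absolute Galois group on the four roots. -/
def perm : GalQ →* Equiv.Perm (Fin 4) where
  toFun σ :=
    { toFun := d.permFun σ
      invFun := d.permFun σ⁻¹
      left_inv := fun i => by rw [← permFun_mul, inv_mul_cancel, permFun_one]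
      right_inv := fun i => by rw [← permFun_mul, mul_inv_cancel, permFun_one] }
  map_one' := Equiv.ext d.permFun_one
  map_mul' σ τ := Equiv.ext (d.permFun_mul σ τ)

theorem root_perm (σ : GalQ) (i : Fin 4) : d.root (d.perm σ i) = σ (d.root i) :=
  d.root_permFun σ i

theorem perm_apply_eq_iff (σ : GalQ) (i j : Fin 4) : d.perm σ i = j ↔ σ (d.root i) = d.root j := by
  rw [← root_perm, d.root_injective.eq_iff]

theorem perm_eq_one_iff (σ : GalQ) : d.perm σ = 1 ↔ ∀ x, quartic c₄ c₆ x = 0 → σ x = x := by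
  simp only [Equiv.ext_iff, quartic_eq_zero_iff d, forall_exists_index,
    forall_apply_eq_imp_iff, Equiv.Perm.one_apply, perm_apply_eq_iff]

theorem map_s₁ {σ : GalQ} {i j : Fin 4} (h0 : d.perm σ 0 = i) (h1 : d.perm σ 1 = j) :
    2 * σ d.s₁ = d.root i + d.root j := by
  rw [perm_apply_eq_iff] at h0 h1
  rw [← h0, ← h1, ← map_add, root_zero, root_one, ← map_ofNat σ 2, ← map_mul]
  congr 1
  ring

/-- Galois multiplies the Vandermonde determinant by the sign, and this determinant is a nonzero
rational multiple of `√-3`. -/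
theorem sign_perm_eq_one_iff (σ : GalQ) :
    Equiv.Perm.sign (d.perm σ) = 1 ↔ σ (2 * d.ζ + 1) = 2 * d.ζ + 1 := by
  set V := (Matrix.vandermonde d.root).det with hV
  have hV0 : V ≠ 0 := Matrix.det_vandermonde_ne_zero_iff.2 d.root_injective
  have h1 : σ V = Equiv.Perm.sign (d.perm σ) * V := by
    rw [hV, ← Matrix.det_permute, AlgEquiv.map_det]
    congr 1
    ext i j
    simp [Matrix.vandermonde_apply, root_perm]
  have h2 : σ V = V ↔ σ (2 * d.ζ + 1) = 2 * d.ζ + 1 := by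
    rw [hV, det_vandermonde_root, map_mul, map_ratCast]
    exact mul_right_inj' d.discr_const_ne_zero
  rw [← h2, h1]
  constructor
  · intro h; rw [h]; simp
  · intro h
    rcases Int.units_eq_one_or (Equiv.Perm.sign (d.perm σ)) with h' | h'
    · exact h'
    · rw [h'] at h
      exact absurd (by simpa using h) (neg_ne_self.2 hV0)

theorem not_isSquare_neg_three : ¬ IsSquare (-3 : ℚ) := by
  rintro ⟨x, hx⟩
  nlinarith [mul_self_nonneg x]

theorem exists_sign_ne_one : ∃ p ∈ d.perm.range, Equiv.Perm.sign p ≠ 1 := by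
  obtain ⟨σ, -, h⟩ := exists_map_eq_and_map_eq_neg (x := 1) (y := 2 * d.ζ + 1) (a := 1) (b := -3)
    (by norm_num) d.sqrt_sq not_isSquare_neg_three (by rw [one_mul]; exact not_isSquare_neg_three)
  refine ⟨_, ⟨σ, rfl⟩, fun h' => ?_⟩
  rw [sign_perm_eq_one_iff, h] at h'
  exact d.sqrt_ne_zero (neg_eq_self.1 h')

/-- The roots determine `s₁`, half the sum of the first two, and hence `δ = (c₄ - s₁²)/12`. -/
theorem three_dvd_card (hD : ∀ b : ℚ, b ^ 3 ≠ D) : 3 ∣ Nat.card d.perm.range := by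
  refine three_dvd_of_cube_root d.perm hD (δ := d.δ) (by rw [d.δ_pow, eq_ratCast]) fun σ hσ => ?_
  have h := d.map_s₁ (σ := σ) (i := 0) (j := 1) (by rw [hσ]; rfl) (by rw [hσ]; rfl)
  have hs : σ d.s₁ = d.s₁ := by
    rw [root_zero, root_one] at h
    linear_combination (1 / 2) * h
  have h2 := congrArg σ d.s₁_sq
  rw [map_pow, hs, d.s₁_sq, map_sub, map_mul, map_ratCast, map_ofNat] at h2
  linear_combination (1 / 12) * h2

theorem exists_perm_ne (h : ¬ ∃ x : ℚ, x ^ 4 - 6 * c₄ * x ^ 2 - 8 * c₆ * x - 3 * c₄ ^ 2 = 0)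
    (i : Fin 4) : ∃ p ∈ d.perm.range, p i ≠ i := by
  by_contra! hcon
  obtain ⟨q, hq⟩ := exists_rat_of_fixed (x := d.root i) fun σ =>
    (d.perm_apply_eq_iff σ i i).1 (hcon _ ⟨σ, rfl⟩)
  have h0 := (d.quartic_eq_zero_iff (d.root i)).2 ⟨i, rfl⟩
  rw [← hq, quartic, eq_ratCast] at h0
  exact h ⟨q, by exact_mod_cast h0⟩

theorem perm_apply_self {i : Fin 4} {q : ℚ} (h : d.root i = q) (σ : GalQ) : d.perm σ i = i := by
  rw [perm_apply_eq_iff, h, map_ratCast]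

/-! #### The Galois group of the quartic -/

theorem perm_range_eq_top (hD : ∀ b : ℚ, b ^ 3 ≠ D)
    (h : ¬ ∃ x : ℚ, x ^ 4 - 6 * c₄ * x ^ 2 - 8 * c₆ * x - 3 * c₄ ^ 2 = 0) : d.perm.range = ⊤ :=
  eq_top_of_fixed_point_free _ (d.exists_perm_ne h) d.exists_sign_ne_one (d.three_dvd_card hD)

theorem card_perm_range_of_root (hD : ∀ b : ℚ, b ^ 3 ≠ D) {q : ℚ} (h : d.root 0 = q) :
    Nat.card d.perm.range = 6 := by
  refine card_of_stabilizer _ ?_ d.exists_sign_ne_one (d.three_dvd_card hD)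
  rintro _ ⟨σ, rfl⟩
  exact d.perm_apply_self h σ

/-! ### The quartic when the discriminant of the curve is a rational cube -/

section RationalCubeRoot

variable {δ : ℚ} (hδ : d.δ = δ)
include hδ

theorem s₂_s₃_sq : (d.s₂ * d.s₃) ^ 2 = ((c₄ ^ 2 + 12 * c₄ * δ + 144 * δ ^ 2 : ℚ) : QBar) := by
  rw [mul_pow, d.s₂_sq, d.s₃_sq, hδ]
  push_cast
  linear_combination (-12 * c₄ * δ + 144 * δ ^ 2 * (d.ζ - 1)) * d.ζ_rel

omit hδ in
theorem norm_pos (hδ : d.δ = δ) : 0 < c₄ ^ 2 + 12 * c₄ * δ + 144 * δ ^ 2 := by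
  have : δ ≠ 0 := fun h => d.δ_ne_zero (by rw [hδ, h, Rat.cast_zero])
  have : 0 < δ ^ 2 := by positivity
  nlinarith [sq_nonneg (c₄ + 6 * δ)]

theorem s₂_s₃_ne_zero : d.s₂ * d.s₃ ≠ 0 := fun h => by
  have h1 := d.s₂_s₃_sq hδ
  rw [h, zero_pow two_ne_zero] at h1
  exact (d.norm_pos hδ).ne (by exact_mod_cast h1)

theorem map_s₁_eq (σ : GalQ) : σ d.s₁ = d.s₁ ∨ σ d.s₁ = -d.s₁ :=
  map_eq_or_eq_neg (a := c₄ - 12 * δ) (by rw [d.s₁_sq, hδ]; push_cast; rfl) σ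

/-- Now `s₁²` is rational, so `σ` maps `2s₁ = root 0 + root 1` to `±2s₁`. The other pairs have sums
`±2s₂`, `±2s₃`, of different squares, so the partition `{0,1} | {2,3}` is preserved. -/
theorem perm_zero_one (σ : GalQ) :
    d.perm σ 0 = 0 ∧ d.perm σ 1 = 1 ∨ d.perm σ 0 = 1 ∧ d.perm σ 1 = 0 ∨
    d.perm σ 0 = 2 ∧ d.perm σ 1 = 3 ∨ d.perm σ 0 = 3 ∧ d.perm σ 1 = 2 := by
  have hne : d.perm σ 0 ≠ d.perm σ 1 := (d.perm σ).injective.ne (by decide)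
  have hs : (2 * σ d.s₁) ^ 2 = (2 * d.s₁) ^ 2 := by
    rcases d.map_s₁_eq hδ σ with h | h <;> rw [h]
    ring
  have h12 : d.s₁ ^ 2 - d.s₂ ^ 2 ≠ 0 := fun h => d.det_ne_zero (by rw [h]; ring)
  have h13 : d.s₁ ^ 2 - d.s₃ ^ 2 ≠ 0 := fun h => d.det_ne_zero (by rw [h]; ring)
  rw [d.map_s₁ rfl rfl] at hs
  generalize d.perm σ 0 = i at *
  generalize d.perm σ 1 = j at *
  fin_cases i <;> fin_cases j <;> first
    | exact absurd rfl hne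
    | decide
    | (exfalso
       simp only [Fin.zero_eta, Fin.mk_one, Fin.reduceFinMk, root_zero, root_one, root_two,
         root_three] at hs
       first
        | exact h12 (by linear_combination -(1 / 4) * hs)
        | exact h13 (by linear_combination -(1 / 4) * hs))

/-- `τ` fixes `√-3` and negates `s₂s₃`, so it negates exactly one of `s₂`, `s₃`. `ω` does the
opposite, so it exchanges them up to sign. Their two composites differ at `s₂`. -/
theorem exists_noncomm (hN : ¬ IsSquare (c₄ ^ 2 + 12 * c₄ * δ + 144 * δ ^ 2)) :
    ∃ p ∈ d.perm.range, ∃ q ∈ d.perm.range, p * q ≠ q * p := by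
  have hw := d.s₂_s₃_sq hδ
  have hw0 := d.s₂_s₃_ne_zero hδ
  have hpos := d.norm_pos hδ
  obtain ⟨τ, hτz, hτw⟩ := exists_map_eq_and_map_eq_neg d.sqrt_sq hw hN (by
    rintro ⟨x, hx⟩; nlinarith [mul_self_nonneg x])
  obtain ⟨ω, hωw, hωz⟩ := exists_map_eq_and_map_eq_neg hw d.sqrt_sq not_isSquare_neg_three (by
    rintro ⟨x, hx⟩; nlinarith [mul_self_nonneg x])
  refine ⟨_, ⟨τ, rfl⟩, _, ⟨ω, rfl⟩, fun h => ?_⟩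
  rw [← map_mul, ← map_mul] at h
  have hs : τ (ω d.s₂) = ω (τ d.s₂) := by
    have h0 := d.root_perm (τ * ω) 0
    have h2 := d.root_perm (τ * ω) 2
    rw [h, root_perm, AlgEquiv.mul_apply, AlgEquiv.mul_apply] at h0 h2
    simp only [root_zero, root_two, map_add, map_sub, map_neg] at h0 h2
    linear_combination -(1 / 2) * h0 - (1 / 2) * h2
  have hτζ : τ d.ζ = d.ζ := by
    rw [map_add, map_mul, map_ofNat, map_one] at hτz
    linear_combination (1 / 2) * hτz
  have hωζ : ω d.ζ = d.ζ ^ 2 := by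
    rw [map_add, map_mul, map_ofNat, map_one] at hωz
    linear_combination (1 / 2) * hωz - d.ζ_rel
  have h2 : τ d.s₂ = d.s₂ ∨ τ d.s₂ = -d.s₂ := by
    rw [← sq_eq_sq_iff_eq_or_eq_neg, ← map_pow, d.s₂_sq, hδ]
    simp only [map_sub, map_mul, map_ratCast, map_ofNat, hτζ]
  have h3 : τ d.s₃ = d.s₃ ∨ τ d.s₃ = -d.s₃ := by
    rw [← sq_eq_sq_iff_eq_or_eq_neg, ← map_pow, d.s₃_sq, hδ]
    simp only [map_sub, map_mul, map_pow, map_ratCast, map_ofNat, hτζ]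
  have h4 : ω d.s₂ = d.s₃ ∨ ω d.s₂ = -d.s₃ := by
    rw [← sq_eq_sq_iff_eq_or_eq_neg, ← map_pow, d.s₂_sq, d.s₃_sq, hδ]
    simp only [map_sub, map_mul, map_ratCast, map_ofNat, hωζ]
  have hs3 : d.s₃ ≠ 0 := right_ne_zero_of_mul hw0
  rw [map_mul] at hτw
  rcases h2 with h2 | h2 <;> rcases h3 with h3 | h3 <;> rcases h4 with h4 | h4 <;>
    rw [h2, h3] at hτw <;> simp only [h2, h4, map_neg, h3, neg_neg] at hs <;> first
    | exact hs3 (self_eq_neg.1 hs)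
    | exact hs3 (neg_eq_self.1 hs)
    | exact hw0 (self_eq_neg.1 (by simpa using hτw))

theorem card_perm_range_of_not_isSquare
    (hN : ¬ IsSquare (c₄ ^ 2 + 12 * c₄ * δ + 144 * δ ^ 2)) : Nat.card d.perm.range = 8 := by
  refine card_of_noncomm _ ?_ (d.exists_noncomm hδ hN)
  rintro _ ⟨σ, rfl⟩
  exact d.perm_zero_one hδ σ

variable {n : ℚ} (hn : n ^ 2 = c₄ ^ 2 + 12 * c₄ * δ + 144 * δ ^ 2)
include hn

/-- `s₂s₃` is rational, hence so are `s₁ = c₆/(s₂s₃)` and `(s₂ + s₃)²`; the first two roots are `s₁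
± (s₂ + s₃)`. -/
theorem perm_zero_one_of_square (σ : GalQ) :
    d.perm σ 0 = 0 ∧ d.perm σ 1 = 1 ∨ d.perm σ 0 = 1 ∧ d.perm σ 1 = 0 := by
  obtain ⟨w, hw⟩ : ∃ w : ℚ, d.s₂ * d.s₃ = w := by
    have h := d.s₂_s₃_sq hδ
    rw [← hn, Rat.cast_pow, sq_eq_sq_iff_eq_or_eq_neg] at h
    rcases h with h | h
    · exact ⟨n, h⟩
    · exact ⟨-n, by rw [h]; push_cast; rfl⟩
  have hw0 := d.s₂_s₃_ne_zero hδ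
  have hs₁ : σ d.s₁ = d.s₁ := by
    have : d.s₁ = ((c₆ / w : ℚ) : QBar) := by
      rw [Rat.cast_div, ← hw, eq_div_iff hw0, ← d.prod]
      ring
    rw [this, map_ratCast]
  have ha : (d.s₂ + d.s₃) ^ 2 = ((2 * c₄ + 12 * δ + 2 * w : ℚ) : QBar) := by
    rw [show (d.s₂ + d.s₃) ^ 2 = d.s₂ ^ 2 + d.s₃ ^ 2 + 2 * (d.s₂ * d.s₃) by ring, hw, d.s₂_sq,
      d.s₃_sq, hδ]
    push_cast
    linear_combination -12 * δ * d.ζ_rel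
  simp only [perm_apply_eq_iff, root_zero, root_one, map_add, map_sub, hs₁]
  rcases map_eq_or_eq_neg ha σ with h | h <;> rw [map_add] at h
  · left
    exact ⟨by linear_combination h, by linear_combination -h⟩
  · right
    exact ⟨by linear_combination h, by linear_combination -h⟩

theorem perm_range_eq_klein
    (h : ¬ ∃ x : ℚ, x ^ 4 - 6 * c₄ * x ^ 2 - 8 * c₆ * x - 3 * c₄ ^ 2 = 0) :
    d.perm.range = kleinPermHom.range := by
  have h01 : ∀ p ∈ d.perm.range, p 0 = 0 ∧ p 1 = 1 ∨ p 0 = 1 ∧ p 1 = 0 := by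
    rintro _ ⟨σ, rfl⟩
    exact d.perm_zero_one_of_square hδ hn σ
  apply le_antisymm
  · exact fun p hp => mem_range_kleinPermHom p (h01 p hp)
  · exact kleinPermHom_range_le _ h01 (d.exists_perm_ne h 0) (d.exists_perm_ne h 2)
      d.exists_sign_ne_one

theorem perm_zero_and_perm_one {q : ℚ} (h : d.root 0 = q) (σ : GalQ) :
    d.perm σ 0 = 0 ∧ d.perm σ 1 = 1 := by
  rcases d.perm_zero_one_of_square hδ hn σ with h' | h'
  · exact h'
  · rw [d.perm_apply_self h] at h'
    exact absurd h'.1 (by decide)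

theorem card_perm_range_eq_two {q : ℚ} (h : d.root 0 = q) : Nat.card d.perm.range = 2 := by
  refine card_eq_two_of_fixed _ ?_ d.exists_sign_ne_one
  rintro _ ⟨σ, rfl⟩
  exact d.perm_zero_and_perm_one hδ hn h σ

end RationalCubeRoot

/-- As `3` is not a square, some `σ` fixes `√-3` and negates `i`. It acts as an even permutation
fixing `0`, so `σ³` is trivial on the roots, yet still negates `i`. -/
theorem exists_perm_pow_three {q : ℚ} (h : d.root 0 = q) {ι : QBar} (hι : ι ^ 2 = -1) :
    ∃ σ : GalQ, d.perm σ ^ 3 = 1 ∧ σ ι = -ι := by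
  obtain ⟨σ, h1, h2⟩ := exists_map_eq_and_map_eq_neg (y := ι) (b := -1) d.sqrt_sq
    (by rw [hι]; norm_num) (by rintro ⟨x, hx⟩; nlinarith [mul_self_nonneg x])
    (by
      rintro ⟨x, hx⟩
      have := not_isSquare_twelve_mul (x := 2 * x) 1 (by linear_combination -4 * hx)
      norm_num at this)
  refine ⟨σ, ?_, h2⟩
  have h3 := (d.sign_perm_eq_one_iff σ).2 h1
  have h4 := d.perm_apply_self h σ
  have key : ∀ p : Equiv.Perm (Fin 4), Equiv.Perm.sign p = 1 → p 0 = 0 → p ^ 3 = 1 := by decide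
  exact key _ h3 h4

end RootData

theorem exists_rootData {c₄ c₆ D : ℚ} (rel : 1728 * D = c₄ ^ 3 - c₆ ^ 2) (ne_zero : D ≠ 0)
    {δ : QBar} (hδ : δ ^ 3 = D) : ∃ d : RootData c₄ c₆ D, d.δ = δ := by
  have hsqrt (a : QBar) : ∃ b, b ^ 2 = a := IsAlgClosed.exists_pow_nat_eq a two_pos
  obtain ⟨z, hz⟩ := hsqrt (-3)
  have hζ : ((z - 1) / 2) ^ 2 + (z - 1) / 2 + 1 = 0 := by linear_combination (1 / 4) * hz
  set ζ := (z - 1) / 2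
  obtain ⟨s₁, h₁⟩ := hsqrt (c₄ - 12 * δ)
  obtain ⟨s₂, h₂⟩ := hsqrt (c₄ - 12 * (ζ * δ))
  obtain ⟨s₃, h₃⟩ := hsqrt (c₄ - 12 * (ζ ^ 2 * δ))
  have hp : (s₁ * s₂ * s₃) ^ 2 = (c₆ : QBar) ^ 2 := by
    have hrel : (1728 : QBar) * D = c₄ ^ 3 - c₆ ^ 2 := by exact_mod_cast rel
    rw [mul_pow, mul_pow, h₁, h₂, h₃]
    linear_combination -hrel - 1728 * hδ + (-12 * c₄ ^ 2 * δ + 144 * c₄ * δ ^ 2 * ζ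
      - 1728 * δ ^ 3 * (ζ - 1)) * hζ
  rcases sq_eq_sq_iff_eq_or_eq_neg.1 hp with h | h
  · exact ⟨⟨δ, ζ, s₁, s₂, s₃, rel, ne_zero, hδ, hζ, h₁, h₂, h₃, h⟩, rfl⟩
  · exact ⟨⟨δ, ζ, s₁, s₂, -s₃, rel, ne_zero, hδ, hζ, h₁, h₂, by rw [neg_sq, h₃],
      by rw [mul_neg, h, neg_neg]⟩, rfl⟩

/-- Changing two of the signs of the `sᵢ` keeps their product and brings any chosen root to index
`0`. -/
theorem exists_rootData_root_zero {c₄ c₆ D : ℚ} (rel : 1728 * D = c₄ ^ 3 - c₆ ^ 2)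
    (ne_zero : D ≠ 0) {δ : QBar} (hδ : δ ^ 3 = D) {x : QBar} (hx : quartic c₄ c₆ x = 0) :
    ∃ d : RootData c₄ c₆ D, d.δ = δ ∧ d.root 0 = x := by
  obtain ⟨d, hd⟩ := exists_rootData rel ne_zero hδ
  obtain ⟨i, rfl⟩ := (d.quartic_eq_zero_iff x).1 hx
  obtain ⟨δ', ζ, s₁, s₂, s₃, _, _, hδ', hζ, h₁, h₂, h₃, h⟩ := d
  fin_cases i
  · exact ⟨_, hd, rfl⟩
  · exact ⟨⟨δ', ζ, s₁, -s₂, -s₃, rel, ne_zero, hδ', hζ, h₁, by rw [neg_sq, h₂],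
      by rw [neg_sq, h₃], by rw [← h]; ring⟩, hd, by simp [RootData.root]; ring⟩
  · exact ⟨⟨δ', ζ, -s₁, s₂, -s₃, rel, ne_zero, hδ', hζ, by rw [neg_sq, h₁], h₂,
      by rw [neg_sq, h₃], by rw [← h]; ring⟩, hd, by simp [RootData.root]; ring⟩
  · exact ⟨⟨δ', ζ, -s₁, -s₂, s₃, rel, ne_zero, hδ', hζ, by rw [neg_sq, h₁],
      by rw [neg_sq, h₂], h₃, by rw [← h]; ring⟩, hd, by simp [RootData.root]; ring⟩

theorem exists_rootData_rat {c₄ c₆ D : ℚ} (rel : 1728 * D = c₄ ^ 3 - c₆ ^ 2) (ne_zero : D ≠ 0)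
    {δ : QBar} (hδ : δ ^ 3 = D) {q : ℚ}
    (hq : q ^ 4 - 6 * c₄ * q ^ 2 - 8 * c₆ * q - 3 * c₄ ^ 2 = 0) :
    ∃ d : RootData c₄ c₆ D, d.δ = δ ∧ d.root 0 = q :=
  exists_rootData_root_zero rel ne_zero hδ (by rw [quartic]; exact_mod_cast hq)

/-! ### Points of order three -/

open WeierstrassCurve

section TorsionPoints

/-- At `z = 12x + b₂` the cubic is `432(2y + a₁x + a₃)²`, so this says that no point has order both
2 and 3. Modulo the cubic, the quartic is `-3(z² - c₄)²`; a common zero would be a double root of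
the cubic and give `D = 0`. -/
theorem cubic_ne_zero {F : Type*} [Field F] [CharZero F] {c₄ c₆ D z : F}
    (rel : 1728 * D = c₄ ^ 3 - c₆ ^ 2) (hD : D ≠ 0)
    (hq : z ^ 4 - 6 * c₄ * z ^ 2 - 8 * c₆ * z - 3 * c₄ ^ 2 = 0) :
    z ^ 3 - 3 * c₄ * z - 2 * c₆ ≠ 0 := by
  intro hf
  have h1 : z ^ 2 - c₄ = 0 := by
    have : (z ^ 2 - c₄) ^ 2 = 0 := by linear_combination (4 / 3) * z * hf - (1 / 3) * hq
    exact pow_eq_zero_iff two_ne_zero |>.1 this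
  have h2 : c₆ = -(c₄ * z) := by linear_combination (-1 / 2) * hf + (1 / 2) * z * h1
  have : 1728 * D = 0 := by
    rw [rel, h2]
    linear_combination -c₄ ^ 2 * h1
  exact hD ((mul_eq_zero.1 this).resolve_left (by norm_num))

-- Away from 2-torsion, `3P = 0` means `2P = -P`, and the duplication formula gives `x(2P) - x =
-- -Ψ₃(x)/(2y + a₁x + a₃)²`.
open scoped Classical in
theorem three_nsmul_eq_zero_iff {F : Type*} [Field F] [CharZero F] (W : WeierstrassCurve F)
    [W.IsElliptic] {x y : F} (h : W.toAffine.Nonsingular x y) :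
    3 • (Affine.Point.some x y h) = 0 ↔ W.Ψ₃.eval x = 0 := by
  have heq := (Affine.equation_iff x y).1 h.1
  have hΨ : W.Ψ₃.eval x = 3 * x ^ 4 + W.b₂ * x ^ 3 + 3 * W.b₄ * x ^ 2 + 3 * W.b₆ * x + W.b₈ := by
    simp [Ψ₃]
  set P := Affine.Point.some x y h with hP
  have hP0 : P ≠ 0 := Affine.Point.some_ne_zero h
  by_cases hy : y = W.toAffine.negY x y
  · have h2 : P + P = 0 := Affine.Point.add_self_of_Y_eq hy
    have h3 : 3 • P = P := by rw [succ_nsmul, two_nsmul, h2, zero_add]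
    rw [h3]
    refine ⟨fun h => absurd h hP0, fun h0 => ?_⟩
    exfalso
    have hy' : 2 * y + W.a₁ * x + W.a₃ = 0 := by
      rw [Affine.negY] at hy
      linear_combination hy
    have hf : (12 * x + W.b₂) ^ 3 - 3 * W.c₄ * (12 * x + W.b₂) - 2 * W.c₆ = 0 := by
      simp only [c₄, c₆, b₂, b₄, b₆]
      linear_combination -1728 * heq + 432 * (2 * y + W.a₁ * x + W.a₃) * hy'
    have hq : (12 * x + W.b₂) ^ 4 - 6 * W.c₄ * (12 * x + W.b₂) ^ 2
        - 8 * W.c₆ * (12 * x + W.b₂) - 3 * W.c₄ ^ 2 = 0 := by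
      rw [hΨ] at h0
      simp only [c₄, c₆, b₂, b₄, b₆, b₈] at h0 ⊢
      linear_combination 6912 * h0
    exact cubic_ne_zero W.c_relation W.isUnit_Δ.ne_zero hq hf
  · have hm : y - W.toAffine.negY x y ≠ 0 := sub_ne_zero.2 hy
    have h3 : 3 • P = 0 ↔ P + P = -P := by
      rw [succ_nsmul, two_nsmul, add_eq_zero_iff_eq_neg]
    -- The impossible alternative `2P = P` is added so that the condition becomes equality of
    -- abscissae.
    have h4 : P + P = -P ↔ P + P = P ∨ P + P = -P :=
      ⟨Or.inr, fun h => h.resolve_left fun h => hP0 (add_eq_left.1 h)⟩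
    rw [h3, h4, hP, Affine.Point.add_self_of_Y_ne hy, ← Affine.Point.X_eq_iff, Affine.addX,
      Affine.slope_of_Y_ne rfl hy, ← sub_eq_zero]
    rw [← mul_eq_zero_iff_left (pow_ne_zero 2 hm), hΨ, ← neg_eq_zero]
    have : ∀ a b : F, a = b → (a = 0 ↔ b = 0) := by rintro a b rfl; rfl
    apply this
    field_simp
    simp only [Affine.negY, b₂, b₄, b₆, b₈]
    linear_combination (12 * x + (W.a₁ ^ 2 + 4 * W.a₂)) * heq

variable (E : WeierstrassCurve ℚ)

theorem quartic_eq_Ψ₃ (x : QBar) :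
    quartic E.c₄ E.c₆ (12 * x + E.b₂) = 6912 * (E.baseChange QBar).Ψ₃.eval x := by
  have h4 : (E.c₄ : QBar) = (E.baseChange QBar).c₄ := by
    rw [baseChange, map_c₄, eq_ratCast]
  have h6 : (E.c₆ : QBar) = (E.baseChange QBar).c₆ := by
    rw [baseChange, map_c₆, eq_ratCast]
  have h2 : (E.b₂ : QBar) = (E.baseChange QBar).b₂ := by
    rw [baseChange, map_b₂, eq_ratCast]
  rw [quartic, h4, h6, h2]
  simp only [Ψ₃, c₄, c₆, b₂, b₄, b₆, b₈]
  simp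
  ring

variable [E.IsElliptic]

instance isElliptic_baseChange_QBar : (E.baseChange QBar).IsElliptic :=
  inferInstanceAs (E.map (algebraMap ℚ QBar)).IsElliptic

theorem mem_torsionX_iff (x : QBar) : x ∈ torsionX E ↔ quartic E.c₄ E.c₆ (12 * x + E.b₂) = 0 := by
  rw [quartic_eq_Ψ₃, mul_eq_zero_iff_left (by norm_num)]
  constructor
  · rintro ⟨y, h, h3⟩
    exact (three_nsmul_eq_zero_iff _ h).1 h3
  · intro h
    set W := E.baseChange QBar
    obtain ⟨y, hy⟩ : ∃ y : QBar, y ^ 2 + (W.a₁ * x + W.a₃) * y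
        - (x ^ 3 + W.a₂ * x ^ 2 + W.a₄ * x + W.a₆) = 0 := by
      obtain ⟨s, hs⟩ := IsAlgClosed.exists_pow_nat_eq ((W.a₁ * x + W.a₃) ^ 2
        + 4 * (x ^ 3 + W.a₂ * x ^ 2 + W.a₄ * x + W.a₆)) two_pos
      exact ⟨(s - (W.a₁ * x + W.a₃)) / 2, by linear_combination (1 / 4) * hs⟩
    have hns : W.toAffine.Nonsingular x y := by
      refine (Affine.equation_iff_nonsingular (W := W)).1 ((Affine.equation_iff x y).2 ?_)
      linear_combination hy
    exact ⟨y, hns, (three_nsmul_eq_zero_iff W hns).2 h⟩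

theorem torsionX_eq_rootSet : torsionX E = E.Ψ₃.rootSet QBar := by
  ext x
  have hne : E.Ψ₃ ≠ 0 := E.Ψ₃_ne_zero (by norm_num)
  rw [mem_torsionX_iff, quartic_eq_Ψ₃, mul_eq_zero_iff_left (by norm_num), mem_rootSet,
    and_iff_right hne, baseChange, map_Ψ₃, eval_map_algebraMap]

theorem divisionPolynomialField_eq :
    divisionPolynomialField E = IntermediateField.adjoin ℚ (torsionX E) := by
  rw [torsionX_eq_rootSet]
  rfl

variable {E}

theorem RootData.perm_ker (d : RootData E.c₄ E.c₆ E.Δ) :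
    d.perm.ker = (divisionPolynomialField E).fixingSubgroup := by
  ext σ
  rw [divisionPolynomialField_eq, mem_fixingSubgroup_adjoin_iff, MonoidHom.mem_ker,
    d.perm_eq_one_iff]
  constructor
  · intro h x hx
    have := h _ ((mem_torsionX_iff E x).1 hx)
    rw [map_add, map_mul, map_ofNat, map_ratCast] at this
    linear_combination (1 / 12) * this
  · intro h z hz
    have h1 : 12 * ((z - E.b₂) / 12) + E.b₂ = z := by ring
    have h2 := h ((z - E.b₂) / 12) ((mem_torsionX_iff E _).2 (by rwa [h1]))
    rw [← h1, map_add, map_mul, map_ofNat, map_ratCast, h2]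

theorem RootData.hasGaloisGroup_divisionPolynomialField (d : RootData E.c₄ E.c₆ E.Δ) {Γ : Type}
    [Group Γ] (e : Nonempty (d.perm.range ≃* Γ)) : HasGaloisGroup (divisionPolynomialField E) Γ :=
  hasGaloisGroup_of_hom _ d.perm d.perm_ker e

end TorsionPoints

section Representation

/-! ### The Galois representation on the `3`-torsion -/

variable (E : WeierstrassCurve ℚ)

open scoped Classical in
/-- The group `E[3]` of points over the algebraic closure. -/
abbrev Torsion : Type :=
  (nsmulAddMonoidHom (α := (E.baseChange QBar).toAffine.Point) 3).ker

open scoped Classical in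
instance : Module (ZMod 3) (Torsion E) :=
  AddCommGroup.zmodModule fun P => Subtype.ext P.2

open scoped Classical in
/-- The action of a Galois automorphism on `E[3]`. -/
def torsionMap (σ : GalQ) : Torsion E →ₗ[ZMod 3] Torsion E :=
  AddMonoidHom.toZModLinearMap 3
    (((Affine.Point.map (W' := E.toAffine) (σ : QBar →ₐ[ℚ] QBar)).comp
      (AddSubgroup.subtype _)).codRestrict _ fun P => by
        change 3 • (Affine.Point.map (W' := E.toAffine) (σ : QBar →ₐ[ℚ] QBar)) P.1 = 0
        rw [← map_nsmul]
        exact (congrArg _ P.2).trans (map_zero _))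

open scoped Classical in
theorem coe_torsionMap (σ : GalQ) (P : Torsion E) :
    (torsionMap E σ P).1 = Affine.Point.map (W' := E.toAffine) (σ : QBar →ₐ[ℚ] QBar) P.1 := rfl

def torsionHom : GalQ →* Module.End (ZMod 3) (Torsion E) where
  toFun := torsionMap E
  map_one' := LinearMap.ext fun P => Subtype.ext (by
    rw [coe_torsionMap]
    rcases P with ⟨_ | ⟨x, y, h⟩, hP⟩ <;> rfl)
  map_mul' σ τ := LinearMap.ext fun P => Subtype.ext (by
    rw [coe_torsionMap]
    rcases P with ⟨_ | ⟨x, y, h⟩, hP⟩ <;> rfl)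

/-! ### The four lines of `E[3]` and the matrix representation -/

section Basis

variable {E} [E.IsElliptic] (d : RootData E.c₄ E.c₆ E.Δ)
include d

open scoped Classical in
theorem RootData.exists_point (i : Fin 4) :
    ∃ P : Torsion E, ∃ (x y : QBar) (h : (E.baseChange QBar).toAffine.Nonsingular x y),
      P.1 = .some x y h ∧ 12 * x + E.b₂ = d.root i := by
  have h1 : 12 * ((d.root i - E.b₂) / 12) + E.b₂ = d.root i := by ring
  obtain ⟨y, h, hy⟩ := (mem_torsionX_iff E ((d.root i - E.b₂) / 12)).2
    (by rw [h1]; exact (d.quartic_eq_zero_iff _).2 ⟨i, rfl⟩)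
  exact ⟨⟨_, hy⟩, _, y, h, rfl, h1⟩

/-- A point of order three above the given root. -/
def RootData.point (i : Fin 4) : Torsion E := (d.exists_point i).choose

open scoped Classical in
theorem RootData.point_spec (i : Fin 4) :
    ∃ (x y : QBar) (h : (E.baseChange QBar).toAffine.Nonsingular x y),
      (d.point i).1 = .some x y h ∧ 12 * x + E.b₂ = d.root i := (d.exists_point i).choose_spec

theorem RootData.point_ne_zero (i : Fin 4) : d.point i ≠ 0 := by
  obtain ⟨x, y, h, hP, -⟩ := d.point_spec i
  intro h0
  rw [h0] at hP
  exact Affine.Point.some_ne_zero h hP.symm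

open scoped Classical in
theorem RootData.point_eq_iff {P : Torsion E} {x y : QBar}
    {h : (E.baseChange QBar).toAffine.Nonsingular x y} (hP : P.1 = .some x y h) (i : Fin 4) :
    (P = d.point i ∨ P = -d.point i) ↔ 12 * x + E.b₂ = d.root i := by
  obtain ⟨x', y', h', hP', hx'⟩ := d.point_spec i
  rw [Subtype.ext_iff, Subtype.ext_iff, NegMemClass.coe_neg, hP, hP', ← Affine.Point.X_eq_iff,
    ← hx']
  constructor
  · rintro rfl; rfl
  · intro h; linear_combination (1 / 12) * h

theorem RootData.exists_eq_point {P : Torsion E} (hP0 : P ≠ 0) :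
    ∃ i, P = d.point i ∨ P = -d.point i := by
  obtain ⟨_ | ⟨x, y, h⟩, hP⟩ := P
  · exact absurd rfl hP0
  · have := (mem_torsionX_iff E x).1 ⟨y, h, hP⟩
    obtain ⟨i, hi⟩ := (d.quartic_eq_zero_iff _).1 this
    exact ⟨i, (d.point_eq_iff rfl i).2 hi.symm⟩

theorem RootData.point_injective {i j : Fin 4}
    (h : d.point i = d.point j ∨ d.point i = -d.point j) :
    i = j := by
  obtain ⟨x, y, hxy, hP, hx⟩ := d.point_spec i
  rw [d.point_eq_iff hP, hx] at h
  exact d.root_injective h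

open scoped Classical in
theorem RootData.torsionMap_point (σ : GalQ) (i : Fin 4) :
    torsionMap E σ (d.point i) = d.point (d.perm σ i) ∨
      torsionMap E σ (d.point i) = -d.point (d.perm σ i) := by
  obtain ⟨x, y, h, hP, hx⟩ := d.point_spec i
  have h1 := coe_torsionMap E σ (d.point i)
  rw [hP, Affine.Point.map_some] at h1
  rw [d.point_eq_iff h1, root_perm, ← hx, map_add, map_mul, map_ofNat, map_ratCast]
  rfl

theorem RootData.finite_torsion : Finite (Torsion E) ∧ Nat.card (Torsion E) ≤ 9 := by
  let f : Option (Fin 4 × Bool) → Torsion E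
    | none => 0
    | some (i, true) => d.point i
    | some (i, false) => -d.point i
  have hf : Function.Surjective f := by
    intro P
    by_cases h0 : P = 0
    · exact ⟨none, h0.symm⟩
    · obtain ⟨i, h | h⟩ := d.exists_eq_point h0
      · exact ⟨some (i, true), h.symm⟩
      · exact ⟨some (i, false), h.symm⟩
  refine ⟨Finite.of_surjective f hf, ?_⟩
  have := Nat.card_le_card_of_surjective f hf
  simpa using this

theorem RootData.linearIndependent_point :
    LinearIndependent (ZMod 3) ![d.point 0, d.point 1] := by
  have key : ∀ a : ZMod 3, a = 0 ∨ a = 1 ∨ a = -1 := by decide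
  have : Fact (Nat.Prime 3) := ⟨Nat.prime_three⟩
  rw [LinearIndependent.pair_iff' (d.point_ne_zero 0)]
  intro a h
  rcases key a with rfl | rfl | rfl
  · rw [zero_smul] at h
    exact d.point_ne_zero 1 h.symm
  · rw [one_smul] at h
    exact absurd (d.point_injective (Or.inl h)) (by decide)
  · rw [neg_smul, one_smul] at h
    exact absurd (d.point_injective (Or.inr (neg_eq_iff_eq_neg.1 h))) (by decide)

/-- Two points above different roots are independent, while dimension 3 would need 27 points and
there are at most `1 + 2 · 4`. -/
theorem RootData.finrank_torsion : Module.finrank (ZMod 3) (Torsion E) = 2 := by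
  have : Fact (Nat.Prime 3) := ⟨Nat.prime_three⟩
  obtain ⟨hfin, hcard⟩ := d.finite_torsion
  have h1 := d.linearIndependent_point.fintype_card_le_finrank
  rw [Fintype.card_fin] at h1
  rw [Module.natCard_eq_pow_finrank (K := ZMod 3), Nat.card_zmod] at hcard
  refine le_antisymm ?_ h1
  by_contra! h2
  have := Nat.pow_le_pow_right (show 0 < 3 by norm_num) (Nat.succ_le_of_lt h2)
  norm_num at this
  omega

/-- The basis of `E[3]` given by the points above the first two roots. -/
def RootData.basis : Module.Basis (Fin 2) (ZMod 3) (Torsion E) :=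
  have : Fact (Nat.Prime 3) := ⟨Nat.prime_three⟩
  basisOfLinearIndependentOfCardEqFinrank d.linearIndependent_point
    (by rw [d.finrank_torsion, Fintype.card_fin])

theorem RootData.basis_zero : d.basis 0 = d.point 0 := by
  simp [RootData.basis]

theorem RootData.basis_one : d.basis 1 = d.point 1 := by
  simp [RootData.basis]

/-- The mod `3` Galois representation. -/
def RootData.rep : GalQ →* GL (Fin 2) (ZMod 3) :=
  MonoidHom.toHomUnits
    (((LinearMap.toMatrixAlgEquiv d.basis).toAlgHom.toMonoidHom).comp (torsionHom E))

theorem RootData.rep_apply (σ : GalQ) (i j : Fin 2) :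
    (d.rep σ).1 i j = d.basis.repr (torsionMap E σ (d.basis j)) i :=
  LinearMap.toMatrixAlgEquiv_apply d.basis (torsionMap E σ) i j

theorem RootData.rep_eq_iff (σ : GalQ) (f : Module.End (ZMod 3) (Torsion E))
    (g : GL (Fin 2) (ZMod 3)) (hg : g.1 = LinearMap.toMatrixAlgEquiv d.basis f) :
    d.rep σ = g ↔ torsionMap E σ = f := by
  rw [Units.ext_iff, hg]
  exact (LinearMap.toMatrixAlgEquiv d.basis).injective.eq_iff

theorem RootData.rep_eq_one_iff (σ : GalQ) : d.rep σ = 1 ↔ ∀ P, torsionMap E σ P = P := by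
  rw [d.rep_eq_iff σ 1 1 (by rw [map_one]; rfl), LinearMap.ext_iff]
  rfl

theorem RootData.rep_eq_neg_one_iff (σ : GalQ) : d.rep σ = -1 ↔ ∀ P, torsionMap E σ P = -P := by
  rw [d.rep_eq_iff σ (-1) (-1) (by rw [map_neg, map_one]; rfl), LinearMap.ext_iff]
  rfl

theorem RootData.rep_ker : d.rep.ker = (torsionField E).fixingSubgroup := by
  classical
  ext σ
  rw [torsionField, mem_fixingSubgroup_adjoin_iff, MonoidHom.mem_ker, d.rep_eq_one_iff]
  constructor
  · intro h z hz
    have key (x y : QBar) (hxy : (E.baseChange QBar).toAffine.Nonsingular x y)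
        (h3 : 3 • Affine.Point.some x y hxy = 0) : σ x = x ∧ σ y = y := by
      have h1 := congrArg Subtype.val (h ⟨_, h3⟩)
      rw [coe_torsionMap, Affine.Point.map_some] at h1
      simpa using h1
    rcases hz with ⟨y, hxy, h3⟩ | ⟨x, hxy, h3⟩
    · exact (key _ y hxy h3).1
    · exact (key x _ hxy h3).2
  · rintro h ⟨_ | ⟨x, y, hxy⟩, h3⟩
    · exact map_zero (torsionMap E σ)
    · apply Subtype.ext
      rw [coe_torsionMap, Affine.Point.map_some]
      have hx := h x (Or.inl ⟨y, hxy, h3⟩)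
      have hy := h y (Or.inr ⟨x, hxy, h3⟩)
      simpa using ⟨hx, hy⟩

omit d [E.IsElliptic] in
/-- A linear map preserving every line up to sign is `1` or `-1`. -/
theorem eq_one_or_eq_neg_one {V : Type*} [AddCommGroup V] [Module (ZMod 3) V]
    (f : V →ₗ[ZMod 3] V) (h : ∀ v, f v = v ∨ f v = -v) : (∀ v, f v = v) ∨ ∀ v, f v = -v := by
  have h2 (v : V) (hv : v = -v) : v = 0 := by
    have h3 : (3 : ZMod 3) • v = 0 := by
      rw [show (3 : ZMod 3) = 0 from rfl, zero_smul]
    have h4 : (3 : ZMod 3) • v = v + v + v := by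
      rw [show (3 : ZMod 3) = 1 + 1 + 1 from rfl, add_smul, add_smul, one_smul]
    rw [h4] at h3
    nth_rewrite 1 [hv] at h3
    simpa using h3
  by_contra! hcon
  obtain ⟨⟨u, hu⟩, ⟨v, hv⟩⟩ := hcon
  -- Here `f u = -u` and `f v = v`; comparing `f (u + v)` with `±(u + v)` forces `u = -u` or `v =
  -- -v`, hence a zero vector.
  have hu' := (h u).resolve_left hu
  have hv' := (h v).resolve_right hv
  rcases h (u + v) with h' | h' <;> rw [map_add, hu', hv'] at h'
  · have := h2 u (add_right_cancel h').symm
    rw [this] at hu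
    exact hu (map_zero f)
  · rw [neg_add] at h'
    have := h2 v (add_left_cancel h')
    rw [this] at hv
    exact hv (by rw [map_zero, neg_zero])

/-- The roots are the points of order 3 up to sign, so a trivial permutation gives `σP = ±P` for
every `P`; by linearity the sign does not depend on `P`. -/
theorem RootData.perm_eq_one_iff_rep (σ : GalQ) :
    d.perm σ = 1 ↔ d.rep σ = 1 ∨ d.rep σ = -1 := by
  rw [d.rep_eq_one_iff, d.rep_eq_neg_one_iff]
  constructor
  · intro h
    apply eq_one_or_eq_neg_one
    intro P
    by_cases h0 : P = 0
    · left; rw [h0, map_zero]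
    · obtain ⟨i, hi⟩ := d.exists_eq_point h0
      have h1 := d.torsionMap_point σ i
      rw [h, Equiv.Perm.one_apply] at h1
      rcases hi with rfl | rfl
      · exact h1
      · rw [map_neg, neg_inj, neg_inj]
        exact h1
  · intro h
    ext1 i
    have h1 := d.torsionMap_point σ i
    have h2 : torsionMap E σ (d.point i) = d.point i ∨ torsionMap E σ (d.point i) = -d.point i :=
      h.imp (fun h => h _) fun h => h _
    refine d.point_injective ?_
    rcases h1 with h1 | h1 <;> rcases h2 with h2 | h2 <;> rw [h1] at h2
    · exact Or.inl h2
    · exact Or.inr h2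
    · exact Or.inr (neg_eq_iff_eq_neg.1 h2)
    · exact Or.inl (neg_inj.1 h2)

/-- The matrix entries that vanish when the first two roots map to each other. -/
theorem RootData.rep_apply_eq_zero {σ : GalQ} {i j : Fin 4} {k l m : Fin 2}
    (hi : d.basis k = d.point i)
    (hj : d.basis l = d.point j) (h : d.perm σ i = j) (hm : m ≠ l) : (d.rep σ).1 m k = 0 := by
  rw [d.rep_apply, hi]
  have h1 := d.torsionMap_point σ i
  rw [h, ← hj] at h1
  rcases h1 with h1 | h1 <;> rw [h1] <;> simp [hm]

theorem RootData.hasGaloisGroup_torsionField {Γ : Type} [Group Γ]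
    (e : Nonempty (d.rep.range ≃* Γ)) : HasGaloisGroup (torsionField E) Γ :=
  hasGaloisGroup_of_hom _ d.rep d.rep_ker e

end Basis

end Representation

/-! ### The five cases -/

section Cases

variable {E : WeierstrassCurve ℚ} [E.IsElliptic]

theorem j_eq : E.j = E.c₄ ^ 3 / E.Δ := by
  rw [j, Units.val_inv_eq_inv_val, coe_Δ', div_eq_inv_mul]

theorem Δ_ne_zero : E.Δ ≠ 0 := E.isUnit_Δ.ne_zero

omit [E.IsElliptic] in
theorem exists_δ : ∃ δ : QBar, δ ^ 3 = E.Δ := IsAlgClosed.exists_pow_nat_eq _ three_pos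

/-! ### Both Galois groups from the resolvent data -/

namespace RootData

variable (d : RootData E.c₄ E.c₆ E.Δ)
include d

theorem nonempty_rep_range_mulEquiv {A : Type*} [Group A] [Finite A]
    (f : A →* GL (Fin 2) (ZMod 3)) (hf : Function.Injective f) (hle : d.rep.range ≤ f.range)
    (hcard : Nat.card A = 2 * Nat.card d.perm.range) (a : A) (ha : f a ^ 2 = -1) :
    Nonempty (d.rep.range ≃* A) :=
  nonempty_range_mulEquiv_of_square d.rep d.perm (-1) d.perm_eq_one_iff_rep GL_neg_one_ne_one
    (by rw [neg_mul_neg, one_mul]) f hf hle hcard a ha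

theorem nonempty_rep_range_mulEquiv_of_card {A : Type*} [Group A] [Finite A]
    (f : A →* GL (Fin 2) (ZMod 3)) (hf : Function.Injective f) (hle : d.rep.range ≤ f.range)
    (hcard : Nat.card A = 2 * Nat.card d.perm.range) (h : -1 ∈ d.rep.range) :
    Nonempty (d.rep.range ≃* A) := by
  apply nonempty_mulEquiv_of_le_range f hf _ hle
  rw [hcard, card_range_eq_two_mul d.rep d.perm (-1) d.perm_eq_one_iff_rep GL_neg_one_ne_one
    (by rw [neg_mul_neg, one_mul]) h]

theorem nonempty_rep_range_mulEquiv_perm_range (h : -1 ∉ d.rep.range) :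
    Nonempty (d.rep.range ≃* d.perm.range) :=
  nonempty_range_mulEquiv_range _ _
    (ker_eq_of_not_mem_range _ _ _ d.perm_eq_one_iff_rep h)

theorem galois_of_generic (hD : ∀ b : ℚ, b ^ 3 ≠ E.Δ)
    (h : ¬ ∃ x : ℚ, x ^ 4 - 6 * E.c₄ * x ^ 2 - 8 * E.c₆ * x - 3 * E.c₄ ^ 2 = 0) :
    HasGaloisGroup (torsionField E) (GL (Fin 2) (ZMod 3)) ∧
      HasGaloisGroup (divisionPolynomialField E) (Equiv.Perm (Fin 4)) := by
  have htop := d.perm_range_eq_top hD h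
  refine ⟨d.hasGaloisGroup_torsionField ?_, d.hasGaloisGroup_divisionPolynomialField ?_⟩
  · refine d.nonempty_rep_range_mulEquiv (MonoidHom.id _) Function.injective_id
      -- The ambient group is all of `GL₂(𝔽₃)`, of order `48 = 2 · 24`; this matrix squares to `-1`.
      (fun g _ => ⟨g, rfl⟩) ?_ (glMk !![0, -1; 1, 0] !![0, 1; -1, 0] (by decide) (by decide))
      (by decide)
    rw [htop, card_GL_two_three, Nat.card_congr Subgroup.topEquiv.toEquiv, Nat.card_eq_fintype_card]
    decide
  · rw [htop]
    exact ⟨Subgroup.topEquiv⟩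

theorem galois_of_root (hD : ∀ b : ℚ, b ^ 3 ≠ E.Δ) {q : ℚ} (h : d.root 0 = q) :
    (-1 ∉ d.rep.range → HasGaloisGroup (torsionField E) (Equiv.Perm (Fin 3))) ∧
    (-1 ∈ d.rep.range → HasGaloisGroup (torsionField E) (DihedralGroup 6)) ∧
    HasGaloisGroup (divisionPolynomialField E) (Equiv.Perm (Fin 3)) := by
  have hcard := d.card_perm_range_of_root hD h
  have hS3 : Nonempty (d.perm.range ≃* Equiv.Perm (Fin 3)) := by
    refine nonempty_mulEquiv_of_le_range stabilizerHom stabilizerHom_injective _ ?_ ?_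
    · rintro _ ⟨σ, rfl⟩
      exact mem_range_stabilizerHom _ (d.perm_apply_self h σ)
    · rw [hcard, Nat.card_eq_fintype_card]
      decide
  refine ⟨fun hm => d.hasGaloisGroup_torsionField ?_, fun hm => d.hasGaloisGroup_torsionField ?_,
    d.hasGaloisGroup_divisionPolynomialField hS3⟩
  · obtain ⟨e⟩ := d.nonempty_rep_range_mulEquiv_perm_range hm
    exact hS3.map e.trans
  · refine d.nonempty_rep_range_mulEquiv_of_card borelHom borelHom_injective ?_ ?_ hm
    · rintro _ ⟨σ, rfl⟩
      exact mem_range_borelHom _ (d.rep_apply_eq_zero d.basis_zero d.basis_zero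
        (d.perm_apply_self h σ) (by decide))
    · rw [hcard, DihedralGroup.nat_card]

instance : Finite SD16 := Finite.of_equiv _ SemidirectProduct.equivProd.symm

theorem galois_of_cube {δ : ℚ} (hδ : d.δ = δ)
    (hN : ¬ IsSquare (E.c₄ ^ 2 + 12 * E.c₄ * δ + 144 * δ ^ 2)) :
    HasGaloisGroup (torsionField E) SD16 ∧
      HasGaloisGroup (divisionPolynomialField E) (DihedralGroup 4) := by
  have hcard := d.card_perm_range_of_not_isSquare hδ hN
  refine ⟨d.hasGaloisGroup_torsionField ?_, d.hasGaloisGroup_divisionPolynomialField ?_⟩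
  -- The permutation image has order 8 and the passage to it loses only `±1`, so the representation
  -- lands in a Sylow 2-subgroup.
  · have hp : IsPGroup 2 d.rep.range := by
      have hperm : IsPGroup 2 d.perm.range := IsPGroup.of_card (n := 3) (by rw [hcard]; norm_num)
      rintro ⟨_, σ, rfl⟩
      obtain ⟨k, hk⟩ := hperm ⟨_, σ, rfl⟩
      have hk' : d.perm (σ ^ 2 ^ k) = 1 := by
        rw [map_pow]
        exact congrArg Subtype.val hk
      refine ⟨k + 1, Subtype.ext ?_⟩
      rw [pow_succ, pow_mul]
      change (d.rep σ ^ 2 ^ k) ^ 2 = 1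
      rw [← map_pow]
      rcases (d.perm_eq_one_iff_rep _).1 hk' with h | h <;> rw [h]
      · exact one_pow 2
      · exact neg_one_sq
    obtain ⟨g, hg⟩ := exists_conj_semidihedralHom _ hp
    refine d.nonempty_rep_range_mulEquiv _
      ((MulAut.conj g).injective.comp semidihedralHom_injective) hg ?_
      -- This is `r²`, whose square `r⁴` maps to `-1`; being central, `-1` is unaffected by the
      -- conjugation.
      (SemidirectProduct.inl (Multiplicative.ofAdd 2)) ?_
    · rw [hcard, SemidirectProduct.card, Nat.card_eq_fintype_card, Nat.card_eq_fintype_card]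
      rfl
    · rw [← map_pow]
      have : semidihedralHom (SemidirectProduct.inl (Multiplicative.ofAdd 2) ^ 2) = -1 := by decide
      change MulAut.conj g (semidihedralHom _) = -1
      rw [this, MulAut.conj_apply, mul_neg_one, neg_mul, mul_inv_cancel]
  · refine nonempty_mulEquiv_of_le_range dihedralPermHom dihedralPermHom_injective _ ?_ ?_
    · rintro _ ⟨σ, rfl⟩
      exact mem_range_dihedralPermHom _ (d.perm_zero_one hδ σ)
    · rw [hcard, DihedralGroup.nat_card]

theorem galois_of_square {δ n : ℚ} (hδ : d.δ = δ)
    (hn : n ^ 2 = E.c₄ ^ 2 + 12 * E.c₄ * δ + 144 * δ ^ 2)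
    (h : ¬ ∃ x : ℚ, x ^ 4 - 6 * E.c₄ * x ^ 2 - 8 * E.c₆ * x - 3 * E.c₄ ^ 2 = 0) :
    HasGaloisGroup (torsionField E) (DihedralGroup 4) ∧
      HasGaloisGroup (divisionPolynomialField E) (C2 × C2) := by
  have hr := d.perm_range_eq_klein hδ hn h
  have e := (MonoidHom.ofInjective kleinPermHom_injective).symm
  refine ⟨d.hasGaloisGroup_torsionField ?_, d.hasGaloisGroup_divisionPolynomialField ?_⟩
  · refine d.nonempty_rep_range_mulEquiv monomialHom monomialHom_injective ?_ ?_
      (DihedralGroup.r 1) (by decide)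
    · rintro _ ⟨σ, rfl⟩
      apply mem_range_monomialHom
      rcases d.perm_zero_one_of_square hδ hn σ with ⟨h0, h1⟩ | ⟨h0, h1⟩
      · exact Or.inl ⟨d.rep_apply_eq_zero d.basis_zero d.basis_zero h0 (by decide),
          d.rep_apply_eq_zero d.basis_one d.basis_one h1 (by decide)⟩
      · exact Or.inr ⟨d.rep_apply_eq_zero d.basis_zero d.basis_one h0 (by decide),
          d.rep_apply_eq_zero d.basis_one d.basis_zero h1 (by decide)⟩
    · rw [hr, Nat.card_congr e.toEquiv, DihedralGroup.nat_card, Nat.card_eq_fintype_card]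
      rfl
  · rw [hr]
    exact ⟨e⟩

theorem galois_of_square_of_root {δ n : ℚ} (hδ : d.δ = δ)
    (hn : n ^ 2 = E.c₄ ^ 2 + 12 * E.c₄ * δ + 144 * δ ^ 2) {q : ℚ} (h : d.root 0 = q) :
    (-1 ∉ d.rep.range → HasGaloisGroup (torsionField E) C2) ∧
    (-1 ∈ d.rep.range → HasGaloisGroup (torsionField E) (C2 × C2)) ∧
    HasGaloisGroup (divisionPolynomialField E) C2 := by
  have hcard := d.card_perm_range_eq_two hδ hn h
  have hC2 : Nonempty (d.perm.range ≃* C2) :=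
    ⟨mulEquivOfPrimeCardEq (p := 2) hcard (by rw [Nat.card_eq_fintype_card]; rfl)⟩
  refine ⟨fun hm => d.hasGaloisGroup_torsionField ?_, fun hm => d.hasGaloisGroup_torsionField ?_,
    d.hasGaloisGroup_divisionPolynomialField hC2⟩
  · obtain ⟨e⟩ := d.nonempty_rep_range_mulEquiv_perm_range hm
    exact hC2.map e.trans
  · refine d.nonempty_rep_range_mulEquiv_of_card diagonalHom diagonalHom_injective ?_ ?_ hm
    · rintro _ ⟨σ, rfl⟩
      obtain ⟨h0, h1⟩ := d.perm_zero_and_perm_one hδ hn h σ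
      exact mem_range_diagonalHom _
        (d.rep_apply_eq_zero d.basis_zero d.basis_zero h0 (by decide))
        (d.rep_apply_eq_zero d.basis_one d.basis_one h1 (by decide))
    · rw [hcard, Nat.card_eq_fintype_card]
      rfl

end RootData

/-! ### Quadratic twists -/

theorem quadraticTwist_c₄ (E : WeierstrassCurve ℚ) (t : ℚ) :
    (quadraticTwist E t).c₄ = t ^ 2 * E.c₄ := by
  simp only [quadraticTwist, c₄, b₂, b₄]
  ring

theorem quadraticTwist_c₆ (E : WeierstrassCurve ℚ) (t : ℚ) :
    (quadraticTwist E t).c₆ = t ^ 3 * E.c₆ := by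
  simp only [quadraticTwist, c₆, b₂, b₄, b₆]
  ring

theorem isElliptic_quadraticTwist {t : ℚ} (ht : t ≠ 0) : (quadraticTwist E t).IsElliptic := by
  rw [isElliptic_iff, quadraticTwist_discriminant, isUnit_iff_ne_zero]
  exact mul_ne_zero (pow_ne_zero 6 ht) Δ_ne_zero

/-- If the image of the Galois representation does not contain `-1`, then the ordinates of the
points of order three are fixed by the automorphisms that fix the abscissae. -/
theorem map_eq_of_neg_one_not_mem (d : RootData E.c₄ E.c₆ E.Δ) (h : -1 ∉ d.rep.range)
    {σ : GalQ} (hσ : d.perm σ = 1) {z w : QBar} (hz : quartic E.c₄ E.c₆ z = 0)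
    (hw : w ^ 2 = 3 * (z ^ 3 - 3 * E.c₄ * z - 2 * E.c₆)) : σ w = w := by
  classical
  have hρ : d.rep σ = 1 := ((d.perm_eq_one_iff_rep σ).1 hσ).resolve_right fun h' => h ⟨σ, h'⟩
  rw [d.rep_eq_one_iff] at hρ
  obtain ⟨x, hx⟩ : ∃ x : QBar, z = 12 * x + E.b₂ := ⟨(z - E.b₂) / 12, by ring⟩
  obtain ⟨y, hy⟩ : ∃ y : QBar, w = 36 * (2 * y + E.a₁ * x + E.a₃) :=
    ⟨(w / 36 - E.a₁ * x - E.a₃) / 2, by ring⟩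
  have hns : (E.baseChange QBar).toAffine.Nonsingular x y := by
    refine (Affine.equation_iff_nonsingular (W := E.baseChange QBar)).1
      ((Affine.equation_iff x y).2 ?_)
    change y ^ 2 + algebraMap ℚ QBar E.a₁ * x * y + algebraMap ℚ QBar E.a₃ * y =
      x ^ 3 + algebraMap ℚ QBar E.a₂ * x ^ 2 + algebraMap ℚ QBar E.a₄ * x + algebraMap ℚ QBar E.a₆
    simp only [eq_ratCast]
    rw [hx, hy] at hw
    simp only [c₄, c₆, b₂, b₄, b₆] at hw
    push_cast at hw
    linear_combination (1 / 5184) * hw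
  rw [hx, quartic_eq_Ψ₃, mul_eq_zero_iff_left (by norm_num)] at hz
  have hP := congrArg Subtype.val (hρ ⟨_, (three_nsmul_eq_zero_iff _ hns).2 hz⟩)
  rw [coe_torsionMap, Affine.Point.map_some] at hP
  have hxy : σ x = x ∧ σ y = y := by simpa using hP
  rw [hy]
  simp only [map_mul, map_add, map_ofNat, map_ratCast, hxy.1, hxy.2]

/-- Passing to `E'` negates the roots and multiplies the ordinates `w` by `i`. If neither image
contained `-1`, an automorphism fixing all roots would fix both `w` and `iw`; but `σ³` from
`exists_perm_pow_three` fixes the roots and negates `i`, while `w ≠ 0`. -/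
theorem neg_one_mem_of_twist {E' : WeierstrassCurve ℚ} [E'.IsElliptic] (h4 : E'.c₄ = E.c₄)
    (h6 : E'.c₆ = -E.c₆) (d : RootData E.c₄ E.c₆ E.Δ) (d' : RootData E'.c₄ E'.c₆ E'.Δ) {q : ℚ}
    (hq : d.root 0 = q) (h : -1 ∉ d.rep.range) : -1 ∈ d'.rep.range := by
  by_contra h'
  obtain ⟨ι, hι⟩ : ∃ ι : QBar, ι ^ 2 = -1 := IsAlgClosed.exists_pow_nat_eq _ two_pos
  obtain ⟨σ, hσ3, hσι⟩ := d.exists_perm_pow_three hq hι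
  have hσ : d.perm (σ ^ 3) = 1 := by rw [map_pow, hσ3]
  have hι3 : (σ ^ 3) ι = -ι := by
    rw [pow_succ, pow_two, AlgEquiv.mul_apply, AlgEquiv.mul_apply, hσι, map_neg, hσι, neg_neg, hσι]
  have hneg (z : QBar) : quartic E.c₄ E.c₆ z = quartic E'.c₄ E'.c₆ (-z) := by
    rw [quartic, quartic, h4, h6]
    push_cast
    ring
  have hσ' : d'.perm (σ ^ 3) = 1 := by
    rw [d'.perm_eq_one_iff]
    intro z hz
    rw [← neg_neg z, ← hneg] at hz
    have := (d.perm_eq_one_iff _).1 hσ _ hz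
    rwa [map_neg, neg_inj] at this
  have hz : quartic E.c₄ E.c₆ (d.root 0) = 0 := (d.quartic_eq_zero_iff _).2 ⟨0, rfl⟩
  obtain ⟨w, hw⟩ : ∃ w : QBar,
      w ^ 2 = 3 * (d.root 0 ^ 3 - 3 * E.c₄ * d.root 0 - 2 * E.c₆) :=
    IsAlgClosed.exists_pow_nat_eq _ two_pos
  have h1 := map_eq_of_neg_one_not_mem d h hσ hz hw
  have h2 := map_eq_of_neg_one_not_mem d' h' hσ' (z := -d.root 0) (w := ι * w)
    (by rw [← hneg, hz]) (by rw [mul_pow, hι, hw, h4, h6]; push_cast; ring)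
  rw [map_mul, h1, hι3, neg_mul, neg_eq_self, mul_eq_zero] at h2
  rcases h2 with h2 | h2
  · rw [h2] at hι
    norm_num at hι
  · rw [h2, zero_pow two_ne_zero, zero_eq_mul] at hw
    refine hw.elim (by norm_num) (cubic_ne_zero (D := (E.Δ : QBar)) ?_ ?_ hz)
    · exact_mod_cast E.c_relation
    · exact Rat.cast_ne_zero.2 Δ_ne_zero

/-- One of `t = 1` and `t = -1` works: these twists share `c₄` and have opposite `c₆`. -/
theorem exists_twist (E : WeierstrassCurve ℚ) : ∃ t : ℚ, t ≠ 0 ∧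
    ∀ [(quadraticTwist E t).IsElliptic] (d : RootData (quadraticTwist E t).c₄
      (quadraticTwist E t).c₆ (quadraticTwist E t).Δ) (q : ℚ), d.root 0 = q → -1 ∈ d.rep.range := by
  by_contra! hcon
  obtain ⟨i₁, d₁, q₁, hq₁, h₁⟩ := hcon 1 one_ne_zero
  obtain ⟨i₂, d₂, q₂, hq₂, h₂⟩ := hcon (-1) (neg_ne_zero.2 one_ne_zero)
  refine h₂ (neg_one_mem_of_twist ?_ ?_ d₁ d₂ hq₁ h₁)
  · rw [quadraticTwist_c₄, quadraticTwist_c₄]; ring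
  · rw [quadraticTwist_c₆, quadraticTwist_c₆]; ring

theorem quadraticTwist_j {t : ℚ} (ht : t ≠ 0) [(quadraticTwist E t).IsElliptic] :
    (quadraticTwist E t).j = E.j := by
  rw [j_eq, j_eq, quadraticTwist_c₄, quadraticTwist_discriminant, mul_pow, ← pow_mul,
    mul_div_mul_left _ _ (pow_ne_zero _ ht)]

/-! ### Classification by the `j`-invariant -/

theorem mem_F₁_iff (hj : E.j ≠ 0) : E.j ∈ F₁ '' ratStar ↔
    ∃ x : ℚ, x ^ 4 - 6 * E.c₄ * x ^ 2 - 8 * E.c₆ * x - 3 * E.c₄ ^ 2 = 0 := by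
  rw [j_eq]
  exact mem_F₁_image_iff E.c_relation Δ_ne_zero (fun h => hj (E.j_eq_zero h))

theorem mem_G₁_iff (hj : E.j ≠ 0) : E.j ∈ G₁ '' ratStar ↔ ∃ δ : ℚ, δ ^ 3 = E.Δ := by
  rw [j_eq]
  exact mem_G₁_image_iff Δ_ne_zero (fun h => hj (E.j_eq_zero h))

theorem mem_G₁_G₂_iff (hj : E.j ≠ 0) : E.j ∈ G₁ '' (G₂ '' ratStar) ↔
    ∃ δ n : ℚ, δ ^ 3 = E.Δ ∧ n ^ 2 = E.c₄ ^ 2 + 12 * E.c₄ * δ + 144 * δ ^ 2 := by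
  rw [j_eq]
  exact mem_G₁_G₂_image_iff Δ_ne_zero (fun h => hj (E.j_eq_zero h))

theorem exists_rootData_of_mem_F₁ (hj : E.j ≠ 0) (h₁ : E.j ∈ F₁ '' ratStar)
    (h₂ : E.j ∉ F₁ '' (F₂ '' ratStar)) :
    (∀ b : ℚ, b ^ 3 ≠ E.Δ) ∧ ∃ (d : RootData E.c₄ E.c₆ E.Δ) (q : ℚ), d.root 0 = q := by
  constructor
  · intro b hb
    exact h₂ (mem_F₁_F₂_image hj h₁ ((mem_G₁_iff hj).2 ⟨b, hb⟩))
  · obtain ⟨q, hq⟩ := (mem_F₁_iff hj).1 h₁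
    obtain ⟨δ, hδ⟩ := exists_δ (E := E)
    obtain ⟨d, -, hd⟩ := exists_rootData_rat E.c_relation Δ_ne_zero hδ hq
    exact ⟨d, q, hd⟩

theorem exists_rootData_of_mem_F₁_F₂ (hj : E.j ≠ 0) (h₁ : E.j ∈ F₁ '' ratStar)
    (h₂ : E.j ∈ G₁ '' (G₂ '' ratStar)) :
    ∃ (d : RootData E.c₄ E.c₆ E.Δ) (q δ n : ℚ), d.root 0 = q ∧ d.δ = δ ∧
      n ^ 2 = E.c₄ ^ 2 + 12 * E.c₄ * δ + 144 * δ ^ 2 := by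
  obtain ⟨q, hq⟩ := (mem_F₁_iff hj).1 h₁
  obtain ⟨δ, n, hδ, hn⟩ := (mem_G₁_G₂_iff hj).1 h₂
  obtain ⟨d, hdδ, hd⟩ := exists_rootData_rat E.c_relation Δ_ne_zero (δ := δ)
    (by exact_mod_cast hδ) hq
  exact ⟨d, q, δ, n, hd, hdδ, hn⟩

theorem generic_case (hj : E.j ≠ 0) (h : E.j ∉ F₁ '' ratStar ∧ E.j ∉ G₁ '' ratStar) :
    HasGaloisGroup (torsionField E) (GL (Fin 2) (ZMod 3)) ∧
      HasGaloisGroup (divisionPolynomialField E) (Equiv.Perm (Fin 4)) := by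
  obtain ⟨δ, hδ⟩ := exists_δ (E := E)
  obtain ⟨d, -⟩ := exists_rootData E.c_relation Δ_ne_zero hδ
  rw [mem_F₁_iff hj, mem_G₁_iff hj] at h
  exact d.galois_of_generic (fun b hb => h.2 ⟨b, hb⟩) h.1

theorem borel_case (hj : E.j ≠ 0)
    (h : E.j ∈ F₁ '' ratStar ∧ E.j ∉ F₁ '' (F₂ '' ratStar)) :
    (HasGaloisGroup (torsionField E) (Equiv.Perm (Fin 3)) ∨
      HasGaloisGroup (torsionField E) (DihedralGroup 6)) ∧
    HasGaloisGroup (divisionPolynomialField E) (Equiv.Perm (Fin 3)) ∧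
    ∃ t : ℚ, t ≠ 0 ∧ HasGaloisGroup (torsionField (quadraticTwist E t)) (DihedralGroup 6) := by
  obtain ⟨hD, d, q, hd⟩ := exists_rootData_of_mem_F₁ hj h.1 h.2
  obtain ⟨h₁, h₂, h₃⟩ := d.galois_of_root hD hd
  refine ⟨?_, h₃, ?_⟩
  · by_cases hm : -1 ∈ d.rep.range
    · exact Or.inr (h₂ hm)
    · exact Or.inl (h₁ hm)
  · obtain ⟨t, ht, htw⟩ := exists_twist E
    have := isElliptic_quadraticTwist (E := E) ht
    rw [← quadraticTwist_j ht] at hj h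
    obtain ⟨hD, d, q, hd⟩ := exists_rootData_of_mem_F₁ hj h.1 h.2
    exact ⟨t, ht, (d.galois_of_root hD hd).2.1 (htw d q hd)⟩

theorem cube_case (hj : E.j ≠ 0)
    (h : E.j ∈ G₁ '' ratStar ∧ E.j ∉ G₁ '' (G₂ '' ratStar)) :
    HasGaloisGroup (torsionField E) SD16 ∧
      HasGaloisGroup (divisionPolynomialField E) (DihedralGroup 4) := by
  rw [mem_G₁_iff hj, mem_G₁_G₂_iff hj] at h
  obtain ⟨⟨δ, hδ⟩, h⟩ := h
  obtain ⟨d, hd⟩ := exists_rootData E.c_relation Δ_ne_zero (δ := δ) (by exact_mod_cast hδ)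
  exact d.galois_of_cube hd fun ⟨n, hn⟩ => h ⟨δ, n, hδ, by rw [hn, pow_two]⟩

/-- A rational root, together with the cube `Δ`, would put `j` in the image of `F₁ ∘ F₂ = G₁ ∘ G₂ ∘
G₃`. -/
theorem square_case (hj : E.j ≠ 0)
    (h : E.j ∈ G₁ '' (G₂ '' ratStar) ∧ E.j ∉ G₁ '' (G₂ '' (G₃ '' ratStar))) :
    HasGaloisGroup (torsionField E) (DihedralGroup 4) ∧
      HasGaloisGroup (divisionPolynomialField E) (C2 × C2) := by
  obtain ⟨δ, n, hδ, hn⟩ := (mem_G₁_G₂_iff hj).1 h.1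
  obtain ⟨d, hd⟩ := exists_rootData E.c_relation Δ_ne_zero (δ := δ) (by exact_mod_cast hδ)
  refine d.galois_of_square hd hn fun hroot => h.2 ?_
  rw [← F₁_F₂_image]
  exact mem_F₁_F₂_image hj ((mem_F₁_iff hj).2 hroot) ((mem_G₁_iff hj).2 ⟨δ, hδ⟩)

theorem split_case (hj : E.j ≠ 0) (h₁ : E.j ∈ F₁ '' ratStar) (h₂ : E.j ∈ G₁ '' (G₂ '' ratStar)) :
    (HasGaloisGroup (torsionField E) C2 ∨ HasGaloisGroup (torsionField E) (C2 × C2)) ∧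
    HasGaloisGroup (divisionPolynomialField E) C2 ∧
    ∃ t : ℚ, t ≠ 0 ∧ HasGaloisGroup (torsionField (quadraticTwist E t)) (C2 × C2) := by
  obtain ⟨d, q, δ, n, hd, hδ, hn⟩ := exists_rootData_of_mem_F₁_F₂ hj h₁ h₂
  obtain ⟨h₃, h₄, h₅⟩ := d.galois_of_square_of_root hδ hn hd
  refine ⟨?_, h₅, ?_⟩
  · by_cases hm : -1 ∈ d.rep.range
    · exact Or.inr (h₄ hm)
    · exact Or.inl (h₃ hm)
  · obtain ⟨t, ht, htw⟩ := exists_twist E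
    have := isElliptic_quadraticTwist (E := E) ht
    rw [← quadraticTwist_j ht] at hj h₁ h₂
    obtain ⟨d, q, δ, n, hd, hδ, hn⟩ := exists_rootData_of_mem_F₁_F₂ hj h₁ h₂
    exact ⟨t, ht, (d.galois_of_square_of_root hδ hn hd).2.1 (htw d q hd)⟩

end Cases

/-! ### Complex multiplication for `j = 0` -/

section CubeRootOfUnity

open scoped Classical

variable {F : Type*} [Field F] [CharZero F] (W : WeierstrassCurve F) (ζ : F)

/-- The abscissa of the image of a point under the automorphism of order three. -/
def rotX (x : F) : F := (ζ * (12 * x + W.b₂) - W.b₂) / 12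

/-- The ordinate of the image of a point under the automorphism of order three. -/
def rotY (x y : F) : F := y + W.a₁ * (x - rotX W ζ x) / 2

variable {W ζ} (hc : W.c₄ = 0) (hζ : ζ ^ 2 + ζ + 1 = 0)

theorem b₄_eq (hc : W.c₄ = 0) : W.b₄ = W.b₂ ^ 2 / 24 := by
  rw [c₄] at hc
  linear_combination -(1 / 24) * hc

-- With `z = 12x + b₂` and `m = 2y + a₁x + a₃` the curve is `432m² = z³ - 2c₆`, and the map is `(z,
-- m) ↦ (ζz, m)`.
include hc hζ in
theorem nonsingular_rot [W.IsElliptic] {x y : F} (h : W.toAffine.Nonsingular x y) :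
    W.toAffine.Nonsingular (rotX W ζ x) (rotY W ζ x y) := by
  have heq := (Affine.equation_iff x y).1 h.1
  refine (Affine.equation_iff_nonsingular (W := W)).1 ((Affine.equation_iff _ _).2 ?_)
  have key (x y : F) : 1728 * (y ^ 2 + W.a₁ * x * y + W.a₃ * y
      - (x ^ 3 + W.a₂ * x ^ 2 + W.a₄ * x + W.a₆)) = 432 * (2 * y + W.a₁ * x + W.a₃) ^ 2
      - ((12 * x + W.b₂) ^ 3 - 3 * W.c₄ * (12 * x + W.b₂) - 2 * W.c₆) := by
    simp only [c₄, c₆, b₂, b₄, b₆]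
    ring
  have h1 := key x y
  have h2 := key (rotX W ζ x) (rotY W ζ x y)
  have hm : 2 * rotY W ζ x y + W.a₁ * rotX W ζ x + W.a₃ = 2 * y + W.a₁ * x + W.a₃ := by
    rw [rotY]; ring
  have hz : 12 * rotX W ζ x + W.b₂ = ζ * (12 * x + W.b₂) := by
    rw [rotX]; ring
  rw [hm, hz, hc] at h2
  rw [hc] at h1
  linear_combination (1 / 1728) * h2 - (1 / 1728) * h1 + heq
    - (1 / 1728) * (12 * x + W.b₂) ^ 3 * (ζ - 1) * hζ

theorem negY_rot (x y : F) : W.toAffine.negY (rotX W ζ x) (rotY W ζ x y) =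
    rotY W ζ x (W.toAffine.negY x y) := by
  simp only [rotY, Affine.negY]
  ring

include hζ in
theorem rotX_injective : Function.Injective (rotX W ζ) := by
  have h0 : ζ ≠ 0 := by rintro rfl; norm_num at hζ
  intro x₁ x₂ h
  simp only [rotX] at h
  have : ζ * (x₁ - x₂) = 0 := by linear_combination h
  exact sub_eq_zero.1 ((mul_eq_zero.1 this).resolve_left h0)

-- The shifted slope `ℓ + a₁/2` is multiplied by `ζ⁻¹ = ζ²`. The tangent case uses `c₄ = 0` in the
-- form `b₄_eq`.
include hc hζ in
theorem slope_rot {x₁ x₂ y₁ y₂ : F} (h₁ : W.toAffine.Equation x₁ y₁) (h₂ : W.toAffine.Equation x₂ y₂)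
    (h : ¬ (x₁ = x₂ ∧ y₁ = W.toAffine.negY x₂ y₂)) :
    W.toAffine.slope (rotX W ζ x₁) (rotX W ζ x₂) (rotY W ζ x₁ y₁) (rotY W ζ x₂ y₂) =
      ζ ^ 2 * W.toAffine.slope x₁ x₂ y₁ y₂ + W.a₁ * (ζ ^ 2 - 1) / 2 := by
  have h0 : ζ ≠ 0 := by rintro rfl; norm_num at hζ
  have h3 : ζ ^ 3 = 1 := by linear_combination (ζ - 1) * hζ
  by_cases hx : x₁ = x₂
  · subst hx
    have hy : y₁ ≠ W.toAffine.negY x₁ y₂ := fun hy => h ⟨rfl, hy⟩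
    have hyy := Affine.Y_eq_of_Y_ne h₁ h₂ rfl hy
    subst hyy
    have hy' : rotY W ζ x₁ y₁ ≠ W.toAffine.negY (rotX W ζ x₁) (rotY W ζ x₁ y₁) := by
      rw [negY_rot]
      simpa [rotY] using hy
    rw [Affine.slope_of_Y_ne rfl hy', Affine.slope_of_Y_ne rfl hy, negY_rot]
    have hm : rotY W ζ x₁ y₁ - rotY W ζ x₁ (W.toAffine.negY x₁ y₁) =
        y₁ - W.toAffine.negY x₁ y₁ := by simp only [rotY]; ring
    have hm0 := sub_ne_zero.2 hy
    rw [hm, div_eq_iff hm0, add_mul, mul_assoc (ζ ^ 2), div_mul_cancel₀ _ hm0]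
    have hb := b₄_eq hc
    simp only [rotY, rotX, Affine.negY]
    simp only [b₂, b₄] at hb ⊢
    linear_combination (1 - ζ ^ 2) / 2 * hb
  · have hx' : rotX W ζ x₁ ≠ rotX W ζ x₂ := (rotX_injective hζ).ne hx
    rw [Affine.slope_of_X_ne hx', Affine.slope_of_X_ne hx]
    have hx0 := sub_ne_zero.2 hx
    have hd : rotX W ζ x₁ - rotX W ζ x₂ = ζ * (x₁ - x₂) := by simp only [rotX]; ring
    rw [hd]
    have hn : rotY W ζ x₁ y₁ - rotY W ζ x₂ y₂ = (y₁ - y₂) + W.a₁ * (1 - ζ) / 2 * (x₁ - x₂) := by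
      simp only [rotY, rotX]; ring
    rw [hn]
    field_simp
    linear_combination (-2 * (y₁ - y₂) - W.a₁ * (x₁ - x₂)) * h3

include hζ in
theorem addX_rot (x₁ x₂ ℓ : F) :
    W.toAffine.addX (rotX W ζ x₁) (rotX W ζ x₂) (ζ ^ 2 * ℓ + W.a₁ * (ζ ^ 2 - 1) / 2) =
      rotX W ζ (W.toAffine.addX x₁ x₂ ℓ) := by
  simp only [rotX, Affine.addX, b₂]
  linear_combination ((ℓ + W.a₁ / 2) ^ 2 * (ζ ^ 2 - ζ)) * hζ

include hζ in
theorem addY_rot (x₁ x₂ y₁ ℓ : F) :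
    W.toAffine.addY (rotX W ζ x₁) (rotX W ζ x₂) (rotY W ζ x₁ y₁)
      (ζ ^ 2 * ℓ + W.a₁ * (ζ ^ 2 - 1) / 2) =
      rotY W ζ (W.toAffine.addX x₁ x₂ ℓ) (W.toAffine.addY x₁ x₂ y₁ ℓ) := by
  rw [Affine.addY, Affine.addY, Affine.negAddY, Affine.negAddY, addX_rot hζ, ← negY_rot]
  generalize W.toAffine.addX x₁ x₂ ℓ = x
  congr 1
  simp only [rotY, rotX]
  linear_combination (ℓ * (x - x₁) * (ζ - 1) + W.a₁ * (x - x₁) * (ζ - 1) / 2) * hζ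

/-- The automorphism of order three of a curve with `j = 0`. -/
def orderThree [W.IsElliptic] (hc : W.c₄ = 0) (hζ : ζ ^ 2 + ζ + 1 = 0) :
    W.toAffine.Point →+ W.toAffine.Point where
  toFun P := match P with
    | 0 => 0
    | .some _ _ h => .some _ _ (nonsingular_rot hc hζ h)
  map_zero' := rfl
  map_add' := by
    rintro (_ | ⟨x₁, y₁, h₁⟩) (_ | ⟨x₂, y₂, h₂⟩)
    any_goals rfl
    by_cases hxy : x₁ = x₂ ∧ y₁ = W.toAffine.negY x₂ y₂
    · obtain ⟨rfl, rfl⟩ := hxy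
      rw [Affine.Point.add_of_Y_eq rfl rfl]
      exact (Affine.Point.add_of_Y_eq rfl (negY_rot _ _).symm).symm
    · have hxy' : ¬ (rotX W ζ x₁ = rotX W ζ x₂ ∧
          rotY W ζ x₁ y₁ = W.toAffine.negY (rotX W ζ x₂) (rotY W ζ x₂ y₂)) := by
        rintro ⟨hx, hy⟩
        have hx := rotX_injective hζ hx
        subst hx
        rw [negY_rot] at hy
        exact hxy ⟨rfl, by simpa [rotY] using hy⟩
      rw [Affine.Point.add_some hxy]
      refine Eq.trans ?_ (Affine.Point.add_some hxy').symm
      simp only [Affine.Point.some.injEq]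
      rw [slope_rot hc hζ h₁.1 h₂.1 hxy, addX_rot hζ, addY_rot hζ]
      exact ⟨rfl, rfl⟩

theorem orderThree_some [W.IsElliptic] {x y : F} (h : W.toAffine.Nonsingular x y) :
    orderThree hc hζ (.some x y h) = .some _ _ (nonsingular_rot hc hζ h) := rfl

theorem isAlgebraicEndomorphism_orderThree [W.IsElliptic] :
    IsAlgebraicEndomorphism W.toAffine (orderThree hc hζ) := by
  refine Or.inr ⟨C (C (ζ / 12) * (C 12 * X + C W.b₂) - C (W.b₂ / 12)),
    X + C (C (W.a₁ / 2) * (X - (C (ζ / 12) * (C 12 * X + C W.b₂) - C (W.b₂ / 12)))), 1, ?_⟩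
  refine (Set.finite_singleton 0).subset ?_
  rintro (_ | ⟨x, y, h⟩) hP
  · rfl
  · exfalso
    apply hP
    have hx : (C (C (ζ / 12) * (C 12 * X + C W.b₂) - C (W.b₂ / 12)) : F[X][X]).evalEval x y /
        (1 : F[X][X]).evalEval x y = rotX W ζ x := by
      simp [evalEval, rotX]
      ring
    have hy : (X + C (C (W.a₁ / 2) * (X - (C (ζ / 12) * (C 12 * X + C W.b₂) - C (W.b₂ / 12)))) :
        F[X][X]).evalEval x y / (1 : F[X][X]).evalEval x y = rotY W ζ x y := by
      simp [evalEval, rotX, rotY]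
      ring
    refine ⟨x, y, h, by rw [hx, hy]; exact nonsingular_rot hc hζ h, rfl, by simp [evalEval], ?_⟩
    rw [orderThree_some]
    simp only [Affine.Point.some.injEq]
    exact ⟨hx.symm, hy.symm⟩

/-- At a point of order 2, where `z³ = 2c₆ ≠ 0`, multiplication by `n` gives `0` or the point
itself, whereas the automorphism moves `z` to `ζz ≠ z`. -/
theorem orderThree_ne_zsmul [IsAlgClosed F] [W.IsElliptic] (n : ℤ) :
    ¬ ∀ P, orderThree hc hζ P = n • P := by
  intro hn
  obtain ⟨z, hz⟩ := IsAlgClosed.exists_pow_nat_eq (2 * W.c₆) three_pos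
  have hz0 : z ≠ 0 := by
    rintro rfl
    have h6 : W.c₆ = 0 := by linear_combination -(1 / 2) * hz
    have hΔ := W.c_relation
    rw [h6, hc] at hΔ
    have : W.Δ = 0 := by linear_combination (1 / 1728) * hΔ
    exact W.isUnit_Δ.ne_zero this
  obtain ⟨x, rfl⟩ : ∃ x, z = 12 * x + W.b₂ := ⟨(z - W.b₂) / 12, by ring⟩
  obtain ⟨y, hy⟩ : ∃ y, 2 * y + W.a₁ * x + W.a₃ = 0 := ⟨-(W.a₁ * x + W.a₃) / 2, by ring⟩
  have h : W.toAffine.Nonsingular x y := by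
    refine (Affine.equation_iff_nonsingular (W := W)).1 ((Affine.equation_iff x y).2 ?_)
    have hz' : (12 * x + W.b₂) ^ 3 - 3 * W.c₄ * (12 * x + W.b₂) - 2 * W.c₆ = 0 := by
      rw [hc]; linear_combination hz
    simp only [c₄, c₆, b₂, b₄, b₆] at hz'
    linear_combination -(1 / 1728) * hz' + (1 / 4) * (2 * y + W.a₁ * x + W.a₃) * hy
  have h2 : (2 : ℤ) • (Affine.Point.some x y h) = 0 := by
    rw [two_zsmul]
    apply Affine.Point.add_self_of_Y_eq
    rw [Affine.negY]
    linear_combination hy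
  have h1 := hn (.some x y h)
  obtain ⟨k, rfl | rfl⟩ := n.even_or_odd'
  · rw [mul_comm, mul_zsmul, h2, zsmul_zero] at h1
    exact Affine.Point.some_ne_zero _ h1
  · rw [add_zsmul, mul_comm, mul_zsmul, h2, zsmul_zero, zero_add, one_zsmul, orderThree_some,
      Affine.Point.some.injEq] at h1
    have h3 : (ζ - 1) * (12 * x + W.b₂) = 0 := by
      have := h1.1
      rw [rotX] at this
      linear_combination 12 * this
    rcases mul_eq_zero.1 h3 with h4 | h4
    · have : ζ = 1 := sub_eq_zero.1 h4
      rw [this] at hζ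
      norm_num at hζ
    · exact hz0 h4

end CubeRootOfUnity

theorem j_ne_zero_of_not_hasCM {E : WeierstrassCurve ℚ} [E.IsElliptic] (h : ¬ HasCM E) :
    E.j ≠ 0 := by
  intro hj
  have hc : (E.baseChange QBar).c₄ = 0 := by
    rw [baseChange, map_c₄, E.j_eq_zero_iff.1 hj, map_zero]
  obtain ⟨s, hs⟩ := IsAlgClosed.exists_pow_nat_eq (-3 : QBar) two_pos
  have hζ : ((s - 1) / 2) ^ 2 + (s - 1) / 2 + 1 = 0 := by linear_combination (1 / 4) * hs
  exact h ⟨orderThree hc hζ, isAlgebraicEndomorphism_orderThree hc hζ, orderThree_ne_zsmul hc hζ⟩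

end

/-! ### Assembly of the cases -/

theorem mainTheorem2 :
    F₁ (F₂ (RatFunc.X : RatFunc ℚ)) = G₁ (G₂ (G₃ (RatFunc.X : RatFunc ℚ))) ∧
    ∀ (E : WeierstrassCurve ℚ) [E.IsElliptic], ¬ HasCM E →
      divisionPolynomialField E = IntermediateField.adjoin ℚ (torsionX E) ∧
      (E.j ∉ F₁ '' ratStar ∧ E.j ∉ G₁ '' ratStar →
        HasGaloisGroup (torsionField E) (GL (Fin 2) (ZMod 3)) ∧
        HasGaloisGroup (divisionPolynomialField E) (Equiv.Perm (Fin 4))) ∧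
      (E.j ∈ F₁ '' ratStar ∧ E.j ∉ F₁ '' (F₂ '' ratStar) →
        (HasGaloisGroup (torsionField E) (Equiv.Perm (Fin 3)) ∨
          HasGaloisGroup (torsionField E) (DihedralGroup 6)) ∧
        HasGaloisGroup (divisionPolynomialField E) (Equiv.Perm (Fin 3)) ∧
        ∃ d : ℚ, d ≠ 0 ∧ HasGaloisGroup (torsionField (quadraticTwist E d)) (DihedralGroup 6)) ∧
      (E.j ∈ G₁ '' ratStar ∧ E.j ∉ G₁ '' (G₂ '' ratStar) →
        HasGaloisGroup (torsionField E) SD16 ∧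
        HasGaloisGroup (divisionPolynomialField E) (DihedralGroup 4)) ∧
      (E.j ∈ G₁ '' (G₂ '' ratStar) ∧ E.j ∉ G₁ '' (G₂ '' (G₃ '' ratStar)) →
        HasGaloisGroup (torsionField E) (DihedralGroup 4) ∧
        HasGaloisGroup (divisionPolynomialField E) (C2 × C2)) ∧
      (¬ (E.j ∉ F₁ '' ratStar ∧ E.j ∉ G₁ '' ratStar) ∧
          ¬ (E.j ∈ F₁ '' ratStar ∧ E.j ∉ F₁ '' (F₂ '' ratStar)) ∧
          ¬ (E.j ∈ G₁ '' ratStar ∧ E.j ∉ G₁ '' (G₂ '' ratStar)) ∧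
          ¬ (E.j ∈ G₁ '' (G₂ '' ratStar) ∧ E.j ∉ G₁ '' (G₂ '' (G₃ '' ratStar))) →
        (HasGaloisGroup (torsionField E) C2 ∨ HasGaloisGroup (torsionField E) (C2 × C2)) ∧
        HasGaloisGroup (divisionPolynomialField E) C2 ∧
        ∃ d : ℚ, d ≠ 0 ∧ HasGaloisGroup (torsionField (quadraticTwist E d)) (C2 × C2)) := by
  refine ⟨F₁_F₂_eq RatFunc.X_ne_zero, fun E _ hCM => ?_⟩
  have hj := j_ne_zero_of_not_hasCM hCM
  refine ⟨divisionPolynomialField_eq E, generic_case hj, borel_case hj, cube_case hj,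
    square_case hj, ?_⟩
  rintro ⟨h₁, h₂, h₃, h₄⟩
  have ht (t : ℚ) : t ^ 2 + 3 * t + 3 ≠ 0 := by nlinarith [sq_nonneg (2 * t + 3)]
  -- Excluding the first four cases leaves exactly the image of `F₁ ∘ F₂ = G₁ ∘ G₂ ∘ G₃`. As `F₂`
  -- and `G₃` preserve `ℚ*`, it lies in both images that `split_case` needs.
  have h₅ : E.j ∈ F₁ '' (F₂ '' ratStar) := by
    by_cases hF : E.j ∈ F₁ '' ratStar
    · exact not_not.1 fun h => h₂ ⟨hF, h⟩
    · have hG : E.j ∈ G₁ '' ratStar := not_not.1 fun h => h₁ ⟨hF, h⟩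
      have hG' : E.j ∈ G₁ '' (G₂ '' ratStar) := not_not.1 fun h => h₃ ⟨hG, h⟩
      rw [F₁_F₂_image]
      exact not_not.1 fun h => h₄ ⟨hG', h⟩
  have hF₂ : F₂ '' ratStar ⊆ ratStar := by
    rintro _ ⟨t, h0, rfl⟩
    exact mul_ne_zero h0 (ht t)
  have hG₃ : G₃ '' ratStar ⊆ ratStar := by
    rintro _ ⟨t, h0, rfl⟩
    exact div_ne_zero (ht t) h0
  refine split_case hj (Set.image_mono hF₂ h₅) ?_
  rw [F₁_F₂_image] at h₅
  exact Set.image_mono (Set.image_mono hG₃) h₅
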